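/- **Theorem (Positive geodesic distance).** Let $(M,g)$ be a smooth Riemannian manifold (Hausdorff, $\sigma$-compact, without boundary) of dimension $n$. Let $\mathfrak X_c(M)$ be the space of smooth compactly supported vector fields on $M$, and $\mathrm{Diff}_c(M)$ the group of smooth diffeomorphisms of $M$ that equal the identity off a compact set. Let $(B_{r_\alpha}(x_\alpha))_\alpha$ be a cover of $M$ by open geodesic balls, $0<r_\alpha\le\infty$, on each of which normal coordinates are defined, i.e. $\exp_{x_\alpha}$, read in an orthonormal frame of $T_{x_\alpha}M\cong\mathbb R^n$, is a diffeomorphism from the ball of radius $r_\alpha$ in $\mathbb R^n$ onto $B_{r_\alpha}(x_\alpha)$, and let $(\rho_\alpha)_\alpha$ be a locally finite smooth partition of unity subordinate to this cover. For $s\in\mathbb R$ and $X\in\mathfrak X_c(M)$ put $$\|X\|_{H^s}^2=\sum_\alpha\sum_{k=1}^n\int_{\mathbb R^n}(1+|\xi|^2)^s\,\bigl|\mathcal F\bigl((\rho_\alpha X)_\alpha^k\bigr)(\xi)\bigr|^2\,d\xi,\qquad \mathcal Ff(\xi)=(2\pi)^{-n/2}\int_{\mathbb R^n}e^{-i\langle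 x,\xi\rangle}f(x)\,dx,$$ where $(\rho_\alpha X)_\alpha^k$, $k=1,\dots,n$, are the components of $\rho_\alpha X$ in the normal coordinates on $B_{r_\alpha}(x_\alpha)$, extended by zero to $\mathbb R^n$. Let $\langle\cdot,\cdot\rangle$ be the inner product defining this norm, or any inner product on $\mathfrak X_c(M)$ equivalent to it, i.e. with $C^{-1}\|X\|_{H^s}^2\le\langle X,X\rangle\le C\|X\|_{H^s}^2$ for some $C>0$ and all $X$, and let $$G_\varphi(X,Y)=\langle X\circ\varphi^{-1},Y\circ\varphi^{-1}\rangle,\qquad \varphi\in\mathrm{Diff}_c(M),\ X,Y\in T_\varphi\mathrm{Diff}_c(M),$$ be the corresponding right-invariant metric of order $s$ on $\mathrm{Diff}_c(M)$. Its geodesic distance $\mathrm{dist}(\varphi_0,\varphi_1)\in[0,\infty]$ is the infimum of the lengths $\int_0^1 G_{\varphi_t}(\partial_t\varphi_t,\partial_t\varphi_t)^{1/2}\,dt$ over all smooth paths $(\varphi_t)_{t\in[0,1]}$ in $\mathrm{Diff}_c(M)$ from $\varphi_0$ to $\varphi_1$, that is, paths such that $(t,x)\mapsto\varphi_t(x)$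 is smooth on $[0,1]\times M$ and all $\varphi_t$ are supported in one compact set ($\mathrm{dist}=\infty$ if there is no such path). If $n=1$ and $s>\tfrac12$, or if $n\ge2$ and $s\ge1$, then $\mathrm{dist}(\varphi_0,\varphi_1)>0$ for all $\varphi_0\neq\varphi_1$ in $\mathrm{Diff}_c(M)$. -/

import Mathlib

open scoped Manifold ContDiff Topology ENNReal

noncomputable section

namespace SobolevDiff

/-- The model space `ℝⁿ` with its Euclidean norm. -/
abbrev Euc (n : ℕ) : Type := EuclideanSpace ℝ (Fin n)

/-! ### Sobolev inner products on `ℝⁿ` -/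

/-- The Fourier transform `(2π)^(-n/2) ∫ e^{-i⟨x,ξ⟩} f(x) dx` of a function on `ℝⁿ`. -/
def fourierT {n : ℕ} (f : Euc n → ℂ) (ξ : Euc n) : ℂ :=
  (((2 * Real.pi) ^ (-(n : ℝ) / 2) : ℝ) : ℂ) *
    ∫ x : Euc n, Complex.exp (-Complex.I * ((inner ℝ x ξ : ℝ) : ℂ)) * f x

/-- The `H^s(ℝⁿ)` inner product of two `ℝⁿ`-valued functions `u`, `v` on `ℝⁿ`: the sum over the
components of the `L²` inner product of `(1+|ξ|²)^{s/2} ℱ uᵏ` and `(1+|ξ|²)^{s/2} ℱ vᵏ`. -/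
def euclideanSobolevInner {n : ℕ} (s : ℝ) (u v : Euc n → Euc n) : ℝ :=
  ∑ k : Fin n, ∫ ξ : Euc n, (1 + ‖ξ‖ ^ 2) ^ s *
    (fourierT (fun x => ((u x k : ℝ) : ℂ)) ξ *
      (starRingEnd ℂ) (fourierT (fun x => ((v x k : ℝ) : ℂ)) ξ)).re

section Manifold

universe u v

variable {n : ℕ} {M : Type u} [TopologicalSpace M] [ChartedSpace (Euc n) M]
  [IsManifold (𝓡 n) ∞ M]

/-! ### Riemannian metrics, geodesics, normal coordinates -/

variable (n M) in
/-- A smooth Riemannian metric on the `n`-dimensional manifold `M`. -/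
abbrev RiemMetric : Type u :=
  Bundle.ContMDiffRiemannianMetric (𝓡 n) ∞ (Euc n) (fun x : M => TangentSpace (𝓡 n) x)

/-- The coefficients `g_y(v, w)` of the metric `g` in the chart `κ`, at the point of `M` with
coordinates `y`. -/
def metricInChart (g : RiemMetric n M) (κ : OpenPartialHomeomorph M (Euc n))
    (y v w : Euc n) : ℝ :=
  g.inner (κ.symm y) (mfderiv (𝓡 n) (𝓡 n) κ.symm y v) (mfderiv (𝓡 n) (𝓡 n) κ.symm y w)

/-- `γ` is a geodesic of `g` on the open set of times `S`: in the chart around `γ t` the curve `c`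
of coordinates satisfies the geodesic equation, written as the Euler-Lagrange equation of the
energy, `d/dt g_c(c', w) = ½ (∂_w g)_c(c', c')` for all `w`, which is the same as
`c''ᵏ + Γᵏ_{ij} c'ⁱ c'ʲ = 0`. -/
def IsGeodesicOn (g : RiemMetric n M) (γ : ℝ → M) (S : Set ℝ) : Prop :=
  ContMDiffOn 𝓘(ℝ, ℝ) (𝓡 n) ∞ γ S ∧
  ∀ t ∈ S, ∀ w : Euc n,
    let κ : OpenPartialHomeomorph M (Euc n) := chartAt (Euc n) (γ t)
    let c : ℝ → Euc n := fun τ => κ (γ τ)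
    HasDerivAt (fun τ => metricInChart g κ (c τ) (deriv c τ) w)
      ((1 / 2) * fderiv ℝ (fun y => metricInChart g κ y (deriv c t) (deriv c t)) (c t) w) t

/-- `κ` is a system of normal coordinates on the ball `B_r(x)`, `0 < r ≤ ∞`: its inverse is the
exponential map `exp_x`, read in an orthonormal frame of `T_x M`, and this is a diffeomorphism from
the ball of radius `r` in `ℝⁿ` onto the open set `κ.source = B_r(x)` of `M`. -/
structure IsNormalChart (g : RiemMetric n M) (x : M) (r : ℝ≥0∞)
    (κ : OpenPartialHomeomorph M (Euc n)) : Prop where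
  radius_pos : 0 < r
  smooth : κ ∈ IsManifold.maximalAtlas (𝓡 n) ∞ M
  target_eq : κ.target = Metric.eball (0 : Euc n) r
  map_zero : κ.symm 0 = x
  orthonormal : ∀ v w : Euc n, metricInChart g κ 0 v w = inner ℝ v w
  geodesic : ∀ v : Euc n,
    IsGeodesicOn g (fun t => κ.symm (t • v)) {t : ℝ | t • v ∈ Metric.eball (0 : Euc n) r}

/-- A cover of `M` by balls `B_{r_α}(x_α)` on which normal coordinates are defined, together with
a (locally finite) smooth partition of unity `ρ_α` subordinate to it. -/
structure NormalCover (g : RiemMetric n M) (ι : Type v) where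
  center : ι → M
  radius : ι → ℝ≥0∞
  chart : ι → OpenPartialHomeomorph M (Euc n)
  isNormal : ∀ α, IsNormalChart g (center α) (radius α) (chart α)
  partition : SmoothPartitionOfUnity ι (𝓡 n) M
  subordinate : partition.IsSubordinate fun α => (chart α).source

/-! ### Compactly supported vector fields and their Sobolev inner products -/

variable (n M) in
/-- The space `𝔛_c(M)` of smooth compactly supported vector fields on `M`. -/
def VectorFieldC : Type u :=
  {X : ContMDiffSection (𝓡 n) (Euc n) ∞ (fun x : M => TangentSpace (𝓡 n) x) //
    ∃ K : Set M, IsCompact K ∧ ∀ x, x ∉ K → X x = 0}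

/-- The vector field `ρ_α X` read in the normal coordinates with index `α`, extended by zero to
a function from `ℝⁿ` to `ℝⁿ`. -/
def localRep {g : RiemMetric n M} {ι : Type v} (A : NormalCover g ι) (α : ι)
    (X : VectorFieldC n M) : Euc n → Euc n :=
  fun y => open scoped Classical in
    if y ∈ (A.chart α).target then
      A.partition α ((A.chart α).symm y) •
        (mfderiv (𝓡 n) (𝓡 n) (A.chart α) ((A.chart α).symm y)
          (X.1 ((A.chart α).symm y)) : Euc n)
    else 0

/-- The `H^s` inner product on `𝔛_c(M)`. For each pair of compactly supported fields only finitely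
many terms of the sum are non-zero. -/
def sobolevInner {g : RiemMetric n M} {ι : Type v} (A : NormalCover g ι) (s : ℝ)
    (X Y : VectorFieldC n M) : ℝ :=
  ∑ᶠ α, euclideanSobolevInner s (localRep A α X) (localRep A α Y)

/-- `B` is equivalent to the `H^s` inner product on `𝔛_c(M)` defined by the cover `A`. -/
def IsEquivToSobolev {g : RiemMetric n M} {ι : Type v} (A : NormalCover g ι) (s : ℝ)
    (B : VectorFieldC n M → VectorFieldC n M → ℝ) : Prop :=
  ∃ C : ℝ, 0 < C ∧ ∀ X : VectorFieldC n M,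
    C⁻¹ * sobolevInner A s X X ≤ B X X ∧ B X X ≤ C * sobolevInner A s X X

/-! ### The diffeomorphism group and the geodesic distance -/

variable (n M) in
/-- The group `Diff_c(M)` of smooth diffeomorphisms of `M` that are the identity off a compact
set. -/
def DiffC : Type u :=
  {φ : M ≃ₘ⟮𝓡 n, 𝓡 n⟯ M // ∃ K : Set M, IsCompact K ∧ ∀ x, x ∉ K → φ x = x}

/-- A smooth path in `Diff_c(M)`, parametrised by `[0,1]`, from `φ₀` to `φ₁`. All diffeomorphisms
of the path are supported in one compact set. The field `velocity t` is the right-trivialised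
velocity `u_t = (∂_t φ_t) ∘ φ_t⁻¹`, which is determined by the path for `t ∈ [0,1]`. -/
structure DiffPath (φ₀ φ₁ : DiffC n M) where
  toFun : ℝ → DiffC n M
  velocity : ℝ → VectorFieldC n M
  source : toFun 0 = φ₀
  target : toFun 1 = φ₁
  smooth : ContMDiffOn (𝓘(ℝ, ℝ).prod (𝓡 n)) (𝓡 n) ∞
    (fun p : ℝ × M => (toFun p.1).1 p.2) (Set.Icc (0 : ℝ) 1 ×ˢ Set.univ)
  support : ∃ K : Set M, IsCompact K ∧
    ∀ t ∈ Set.Icc (0 : ℝ) 1, ∀ x, x ∉ K → (toFun t).1 x = x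
  velocity_eq : ∀ t ∈ Set.Icc (0 : ℝ) 1, ∀ x : M,
    mfderivWithin 𝓘(ℝ, ℝ) (𝓡 n) (fun τ : ℝ => (toFun τ).1 x) (Set.Icc 0 1) t (1 : ℝ) =
      (velocity t).1 ((toFun t).1 x)

/-- The length `∫₀¹ G_{φ_t}(∂_tφ, ∂_tφ)^{1/2} dt` of a path for the right-invariant metric
`G_φ(X, Y) = B(X ∘ φ⁻¹, Y ∘ φ⁻¹)` on `Diff_c(M)`. -/
def DiffPath.length {φ₀ φ₁ : DiffC n M} (B : VectorFieldC n M → VectorFieldC n M → ℝ)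
    (p : DiffPath φ₀ φ₁) : ℝ≥0∞ :=
  ∫⁻ t in Set.Icc (0 : ℝ) 1, ENNReal.ofReal (Real.sqrt (B (p.velocity t) (p.velocity t)))

/-- The geodesic distance on `Diff_c(M)` of the right-invariant metric induced by `B`: the infimum
of the lengths of all paths between two diffeomorphisms (`∞` if there is no such path). -/
def geodesicDist (B : VectorFieldC n M → VectorFieldC n M → ℝ) (φ₀ φ₁ : DiffC n M) : ℝ≥0∞ :=
  ⨅ p : DiffPath φ₀ φ₁, p.length B

end Manifold

end SobolevDiff

end

/-! It suffices to find, for every path from `φ₀` to `φ₁`, a scalar quantity `Φ(t)` whose total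
change is at least a fixed `c > 0` and whose derivative is at most a fixed multiple of the `H^s`
norm of the velocity `u_t`. Integrating in time then bounds every length from below by the same
positive number (`geodesicDist_pos`).

Above the Sobolev threshold, `s > n/2`, one can follow a single point: `Φ(t) = f(φ_t(x))`, with `f`
a bump function separating `φ₀(x)` from `φ₁(x)`. Its derivative is `df(u_t)` at `φ_t(x)`, and `H^s`
controls point values of `u_t`. This settles `n = 1`.

For `s ≥ 1` point values may be out of reach, so the observation is averaged in space. Put `h_t = f
∘ φ_t⁻¹` and `Φ(t) = ∫ h_t η` in a chart. The transport equation gives `Φ' = -∫ η dh_t(u_t)`.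
Nothing bounds `dh_t` uniformly over all paths, but integration by parts moves the derivative onto
`η u_t`, and `|h_t| ≤ 1` always holds because composition preserves the bound on `f`. Thus `|Φ'|` is
at most the `L¹` norm of first derivatives of `η u_t`, hence at most `C ‖u_t‖_{H¹}` by
Cauchy-Schwarz (`exists_abs_integral_fderiv_le`).

The norm only sees the localised fields `ρ_α u`. Both arguments therefore take place where one `ρ_α`
is positive, and divide by it. The second also needs `h_t` to be jointly smooth in time and space
(`DiffPath.contMDiffAt_inverse`). -/

noncomputable section

namespace SobolevDiff

open MeasureTheory

section Fourier

open FourierTransform SchwartzMap LineDeriv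

/-! ### Sobolev norms of scalar functions on `ℝⁿ` -/

/-- The squared `H^s` norm of a complex valued function on `ℝⁿ`. -/
def sobolevNormSq {n : ℕ} (s : ℝ) (f : Euc n → ℂ) : ℝ :=
  ∫ ξ : Euc n, (1 + ‖ξ‖ ^ 2) ^ s * ‖fourierT f ξ‖ ^ 2

theorem sobolevNormSq_nonneg {n : ℕ} (s : ℝ) (f : Euc n → ℂ) : 0 ≤ sobolevNormSq s f :=
  integral_nonneg fun _ => by positivity

theorem euclideanSobolevInner_self {n : ℕ} (s : ℝ) (u : Euc n → Euc n) :
    euclideanSobolevInner s u u = ∑ k, sobolevNormSq s (fun x => ((u x k : ℝ) : ℂ)) := by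
  unfold euclideanSobolevInner sobolevNormSq
  refine Finset.sum_congr rfl fun k _ => integral_congr_ae (.of_forall fun ξ => ?_)
  simp only [Complex.mul_conj, Complex.ofReal_re, Complex.normSq_eq_norm_sq]

theorem fourierT_eq {n : ℕ} (f : Euc n → ℂ) (ξ : Euc n) :
    fourierT f ξ = (((2 * Real.pi) ^ (-(n : ℝ) / 2) : ℝ) : ℂ) * 𝓕 f ((2 * Real.pi)⁻¹ • ξ) := by
  rw [fourierT, Real.fourier_eq']
  congr 1
  refine integral_congr_ae (.of_forall fun x => ?_)
  simp only [inner_smul_right, smul_eq_mul]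
  congr 2
  have : (Real.pi : ℂ) ≠ 0 := by exact_mod_cast Real.pi_ne_zero
  push_cast
  field_simp

/-- Substituting `ξ ↦ 2πξ` produces the Jacobian `(2π)^n`, which cancels the square of the
normalising factor `(2π)^(-n/2)`; only the weight is rescaled. -/
theorem sobolevNormSq_eq {n : ℕ} (s : ℝ) (f : Euc n → ℂ) :
    sobolevNormSq s f = ∫ ξ : Euc n, (1 + ‖(2 * Real.pi) • ξ‖ ^ 2) ^ s * ‖𝓕 f ξ‖ ^ 2 := by
  have hpi : (0 : ℝ) < 2 * Real.pi := by positivity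
  have h := Measure.integral_comp_smul (volume : Measure (Euc n))
    (fun ξ : Euc n => (1 + ‖(2 * Real.pi) • ξ‖ ^ 2) ^ s * ‖𝓕 f ξ‖ ^ 2) (2 * Real.pi)⁻¹
  have e : ∀ ξ : Euc n, (1 + ‖ξ‖ ^ 2) ^ s * ‖fourierT f ξ‖ ^ 2 =
      ((2 * Real.pi) ^ n)⁻¹ * ((1 + ‖(2 * Real.pi) • (2 * Real.pi)⁻¹ • ξ‖ ^ 2) ^ s *
        ‖𝓕 f ((2 * Real.pi)⁻¹ • ξ)‖ ^ 2) := by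
    intro ξ
    have hc : ((2 * Real.pi) ^ (-(n : ℝ) / 2)) ^ 2 = ((2 * Real.pi) ^ n)⁻¹ := by
      rw [← Real.rpow_natCast, ← Real.rpow_mul hpi.le, ← Real.rpow_natCast, ← Real.rpow_neg hpi.le]
      congr 1
      push_cast
      ring
    rw [fourierT_eq, norm_mul, mul_pow, Complex.norm_real, Real.norm_eq_abs, sq_abs, hc,
      smul_inv_smul₀ hpi.ne']
    ring
  unfold sobolevNormSq
  simp_rw [e]
  rw [integral_const_mul, h]
  simp only [finrank_euclideanSpace, Fintype.card_fin, smul_eq_mul, inv_pow, inv_inv]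
  rw [abs_of_pos (by positivity), inv_mul_cancel_left₀ (by positivity)]

/-- The square root of the weight has temperate growth, so its product with `f` is again Schwartz
and hence in `L²`. Without integrability the integral would be zero by default and could not serve
as an upper bound. -/
theorem integrable_weight_mul_norm_sq {n : ℕ} (s : ℝ) (f : 𝓢(Euc n, ℂ)) :
    Integrable fun ξ : Euc n => (1 + ‖(2 * Real.pi) • ξ‖ ^ 2) ^ s * ‖f ξ‖ ^ 2 := by
  have hg : Function.HasTemperateGrowth
      (fun x : Euc n => ((1 + ‖(2 * Real.pi) • x‖ ^ 2) ^ (s / 2) : ℝ)) := by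
    have h1 : Function.HasTemperateGrowth (fun x : Euc n => (1 + ‖x‖ ^ 2) ^ (s / 2)) := by fun_prop
    exact h1.comp ((2 * Real.pi) • ContinuousLinearMap.id ℝ (Euc n)).hasTemperateGrowth
  have h := (smulLeftCLM ℂ (fun x : Euc n => ((1 + ‖(2 * Real.pi) • x‖ ^ 2) ^ (s / 2) : ℝ))
    f).memLp 2 volume
  have h2 := h.integrable_norm_pow (by norm_num)
  refine h2.congr (.of_forall fun ξ => ?_)
  simp only [smulLeftCLM_apply_apply hg]
  rw [norm_smul, Real.norm_of_nonneg (by positivity), mul_pow,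
    ← Real.rpow_natCast, ← Real.rpow_mul (by positivity)]
  norm_num

theorem one_le_weight {n : ℕ} {s : ℝ} (hs : 0 ≤ s) (ξ : Euc n) :
    1 ≤ (1 + ‖(2 * Real.pi) • ξ‖ ^ 2) ^ s :=
  Real.one_le_rpow (by nlinarith [sq_nonneg ‖(2 * Real.pi) • ξ‖]) hs

theorem integral_norm_sq_le_sobolevNormSq {n : ℕ} {s : ℝ} (hs : 0 ≤ s) (f : 𝓢(Euc n, ℂ)) :
    ∫ x, ‖f x‖ ^ 2 ≤ sobolevNormSq s f := by
  rw [← integral_norm_sq_fourier, sobolevNormSq_eq]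
  refine integral_mono_of_nonneg (.of_forall fun _ => by positivity)
    (integrable_weight_mul_norm_sq s (𝓕 f)) (.of_forall fun ξ => ?_)
  exact le_mul_of_one_le_left (by positivity) (one_le_weight hs ξ)

/-- By Plancherel: `∂_m` becomes multiplication by `2πi⟨ξ, m⟩`, whose squared modulus is below the
weight of order one. -/
theorem integral_norm_sq_fderiv_le_sobolevNormSq {n : ℕ} {s : ℝ} (hs : 1 ≤ s)
    (f : 𝓢(Euc n, ℂ)) {m : Euc n} (hm : ‖m‖ ≤ 1) :
    ∫ x, ‖fderiv ℝ f x m‖ ^ 2 ≤ sobolevNormSq s f := by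
  have h : ∀ x, fderiv ℝ f x m = (∂_{m} f) x := fun x =>
    (lineDerivOp_apply_eq_fderiv m f x).symm
  simp_rw [h]
  rw [← integral_norm_sq_fourier, sobolevNormSq_eq]
  refine integral_mono_of_nonneg (.of_forall fun _ => by positivity)
    (integrable_weight_mul_norm_sq s (𝓕 f)) (.of_forall fun ξ => ?_)
  have hg : (inner ℝ · m : Euc n → ℝ).HasTemperateGrowth := by fun_prop
  simp only [fourier_lineDerivOp_eq, smul_apply, smulLeftCLM_apply_apply hg]
  rw [norm_smul, norm_smul, mul_pow, mul_pow, ← mul_assoc]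
  refine mul_le_mul_of_nonneg_right ?_ (by positivity)
  have h1 : ‖(inner ℝ ξ m : ℝ)‖ ≤ ‖ξ‖ :=
    (norm_inner_le_norm ξ m).trans (mul_le_of_le_one_right (norm_nonneg _) hm)
  have hpi : (0 : ℝ) < 2 * Real.pi := by positivity
  have h2 : ‖(2 * Real.pi * Complex.I : ℂ)‖ = 2 * Real.pi := by
    simp [abs_of_pos Real.pi_pos]
  rw [h2]
  calc (2 * Real.pi) ^ 2 * ‖(inner ℝ ξ m : ℝ)‖ ^ 2 ≤ (2 * Real.pi) ^ 2 * ‖ξ‖ ^ 2 := by gcongr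
    _ = ‖(2 * Real.pi) • ξ‖ ^ 2 := by rw [norm_smul, Real.norm_of_nonneg hpi.le, mul_pow _ ‖ξ‖]
    _ ≤ (1 + ‖(2 * Real.pi) • ξ‖ ^ 2) ^ (1 : ℝ) := by rw [Real.rpow_one]; linarith
    _ ≤ _ := Real.rpow_le_rpow_of_exponent_le (by nlinarith [sq_nonneg ‖(2 * Real.pi) • ξ‖]) hs

/-- Cauchy-Schwarz for the integral of a product of non-negative functions. -/
theorem integral_mul_le_sqrt_mul_sqrt {X : Type*} [MeasurableSpace X] {μ : Measure X}
    {f g : X → ℝ} (hf0 : 0 ≤ f) (hg0 : 0 ≤ g) (hf : MemLp f 2 μ) (hg : MemLp g 2 μ) :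
    ∫ x, f x * g x ∂μ ≤ √(∫ x, f x ^ 2 ∂μ) * √(∫ x, g x ^ 2 ∂μ) := by
  have h := integral_mul_le_Lp_mul_Lq_of_nonneg (p := 2) (q := 2) (μ := μ) (f := f) (g := g)
    (Real.holderConjugate_iff.2 (by norm_num)) (.of_forall hf0) (.of_forall hg0)
    (by simpa using hf) (by simpa using hg)
  simpa [Real.sqrt_eq_rpow] using h

/-- The Sobolev embedding of `H^s` into the bounded functions for `s > n/2`. -/
theorem exists_norm_le_sqrt_sobolevNormSq {n : ℕ} {s : ℝ} (hs : (n : ℝ) / 2 < s) :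
    ∃ C : ℝ, 0 ≤ C ∧ ∀ (f : 𝓢(Euc n, ℂ)) (x : Euc n), ‖f x‖ ≤ C * √(sobolevNormSq s f) := by
  have hpi : (0 : ℝ) < 2 * Real.pi := by positivity
  set p : Euc n → ℝ := fun ξ => (1 + ‖(2 * Real.pi) • ξ‖ ^ 2) ^ (-s / 2) with hp
  set q : Euc n → ℝ := fun ξ => (1 + ‖(2 * Real.pi) • ξ‖ ^ 2) ^ (s / 2) with hq
  have hpc : Continuous p := by
    refine Continuous.rpow_const (by fun_prop) fun ξ => Or.inl (by positivity)
  have hqc : Continuous q := by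
    refine Continuous.rpow_const (by fun_prop) fun ξ => Or.inl (by positivity)
  have hp2 : ∀ ξ, p ξ ^ 2 = (1 + ‖(2 * Real.pi) • ξ‖ ^ 2) ^ (-(2 * s) / 2) := fun ξ => by
    rw [hp, ← Real.rpow_natCast, ← Real.rpow_mul (by positivity)]
    congr 1
    push_cast
    ring
  have hpm : MemLp p 2 := by
    rw [memLp_two_iff_integrable_sq hpc.aestronglyMeasurable]
    simp_rw [hp2]
    -- The threshold enters here: `(1 + |ξ|²)^(-s)` is integrable on `ℝⁿ` because `2s > n`.
    have := integrable_rpow_neg_one_add_norm_sq (E := Euc n) (μ := volume) (r := 2 * s)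
      (by simp; linarith)
    exact (integrable_comp_smul_iff (volume : Measure (Euc n)) _ hpi.ne').2 this
  refine ⟨√(∫ ξ, p ξ ^ 2), Real.sqrt_nonneg _, fun f x => ?_⟩
  have hq2 : ∀ ξ, (q ξ * ‖𝓕 f ξ‖) ^ 2 = (1 + ‖(2 * Real.pi) • ξ‖ ^ 2) ^ s * ‖𝓕 f ξ‖ ^ 2 :=
    fun ξ => by
      rw [mul_pow, hq, ← Real.rpow_natCast, ← Real.rpow_mul (by positivity)]
      norm_num
  have hqm : MemLp (fun ξ => q ξ * ‖𝓕 f ξ‖) 2 := by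
    rw [memLp_two_iff_integrable_sq (Continuous.aestronglyMeasurable (by fun_prop))]
    simp_rw [hq2]
    exact integrable_weight_mul_norm_sq s (𝓕 f)
  have hinv : f x = ∫ ξ, Real.fourierChar (inner ℝ ξ x) • 𝓕 f ξ := by
    have h0 : 𝓕⁻ (𝓕 f) = f := FourierTransform.fourierInv_fourier_eq f
    conv_lhs => rw [← h0, SchwartzMap.fourierInv_coe, Real.fourierInv_eq]
  have hsq : ∫ ξ, (q ξ * ‖𝓕 f ξ‖) ^ 2 = sobolevNormSq s f := by
    rw [sobolevNormSq_eq]; simp_rw [hq2]; rfl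
  rw [← hsq]
  -- Cauchy-Schwarz for `p · (q ‖𝓕 f‖)`, where `p q = 1`, applied to the Fourier inversion formula.
  refine le_trans ?_ (integral_mul_le_sqrt_mul_sqrt (fun ξ => ?_) (fun ξ => ?_) hpm hqm)
  · rw [hinv]
    refine (norm_integral_le_integral_norm _).trans_eq
      (integral_congr_ae (.of_forall fun ξ => ?_))
    have : p ξ * q ξ = 1 := by
      rw [hp, hq, ← Real.rpow_add (by positivity)]
      ring_nf
      simp
    simp only [Circle.norm_smul]
    rw [← mul_assoc, this, one_mul]
  · simp only [hp]; positivity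
  · simp only [hq]; positivity

end Fourier

universe u v

variable {n : ℕ} {M : Type u} [TopologicalSpace M] [ChartedSpace (Euc n) M]
  [IsManifold (𝓡 n) ∞ M]

/-! ### Vector fields in charts -/

/-- The vector field `X` read in the chart `κ`. -/
def chartField (κ : OpenPartialHomeomorph M (Euc n)) (X : VectorFieldC n M) : Euc n → Euc n :=
  fun y => mfderiv (𝓡 n) (𝓡 n) κ (κ.symm y) (X.1 (κ.symm y))

theorem contDiffOn_chartField {κ : OpenPartialHomeomorph M (Euc n)}
    (hκ : κ ∈ IsManifold.maximalAtlas (𝓡 n) ∞ M) (X : VectorFieldC n M) :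
    ContDiffOn ℝ ∞ (chartField κ X) κ.target := by
  rw [← contMDiffOn_iff_contDiffOn]
  have : IsManifold (𝓡 n) 1 M := IsManifold.of_le (n := ∞) (by simp)
  have h1 := contMDiffOn_of_mem_maximalAtlas hκ
  have h2 := contMDiffOn_symm_of_mem_maximalAtlas hκ
  have h3 := h1.contMDiffOn_tangentMapWithin (m := ∞) (by simp) κ.open_source.uniqueMDiffOn
  have h4 : ContMDiffOn (𝓡 n) (𝓡 n).tangent ∞
      (fun y => (⟨κ.symm y, X.1 (κ.symm y)⟩ : TangentBundle (𝓡 n) M)) κ.target :=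
    X.1.contMDiff_toFun.comp_contMDiffOn h2
  have h5 := h3.comp h4 fun y hy => κ.map_target hy
  have h6 := (contMDiff_snd_tangentBundle_modelSpace (Euc n) (𝓡 n) (n := ∞)).comp_contMDiffOn h5
  refine h6.congr fun y hy => ?_
  exact (congrArg (fun L : TangentSpace (𝓡 n) (κ.symm y) →L[ℝ] Euc n => L (X.1 (κ.symm y)))
    (mfderivWithin_of_isOpen κ.open_source (κ.map_target hy))).symm

theorem chartField_eq_zero {κ : OpenPartialHomeomorph M (Euc n)} {X : VectorFieldC n M}
    {y : Euc n} (h : X.1 (κ.symm y) = 0) : chartField κ X y = 0 :=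
  (congrArg (mfderiv (𝓡 n) (𝓡 n) κ (κ.symm y)) h).trans (map_zero _)

theorem localRep_apply_of_mem {g : RiemMetric n M} {ι : Type v} (A : NormalCover g ι) (α : ι)
    (X : VectorFieldC n M) {y : Euc n} (hy : y ∈ (A.chart α).target) :
    localRep A α X y =
      A.partition α ((A.chart α).symm y) • chartField (A.chart α) X y :=
  if_pos hy

theorem localRep_apply_of_notMem {g : RiemMetric n M} {ι : Type v} (A : NormalCover g ι) (α : ι)
    (X : VectorFieldC n M) {y : Euc n} (hy : y ∉ (A.chart α).target) : localRep A α X y = 0 :=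
  if_neg hy

/-- The support of `ρ_α` lies in the chart domain but need not be compact; intersecting it with the
compact support of `X` makes it so. This is why extension by zero stays smooth. -/
theorem exists_isCompact_localRep_eq_zero {g : RiemMetric n M} {ι : Type v} (A : NormalCover g ι)
    (α : ι) (X : VectorFieldC n M) :
    ∃ L ⊆ (A.chart α).target, IsCompact L ∧ ∀ y ∉ L, localRep A α X y = 0 := by
  obtain ⟨K, hK, hX⟩ := X.2
  have hsub : K ∩ tsupport (A.partition α) ⊆ (A.chart α).source :=
    Set.inter_subset_right.trans (A.subordinate α)
  refine ⟨A.chart α '' (K ∩ tsupport (A.partition α)), ?_, ?_, fun y hy => ?_⟩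
  · rintro _ ⟨x, hx, rfl⟩
    exact (A.chart α).map_source (hsub hx)
  · exact (hK.inter_right (isClosed_tsupport _)).image_of_continuousOn
      ((A.chart α).continuousOn.mono hsub)
  · by_cases hyt : y ∈ (A.chart α).target
    · rw [localRep_apply_of_mem A α X hyt]
      by_cases h1 : (A.chart α).symm y ∈ tsupport (A.partition α)
      · have h2 : (A.chart α).symm y ∉ K := fun h2 =>
          hy ⟨_, ⟨h2, h1⟩, (A.chart α).right_inv hyt⟩
        rw [chartField_eq_zero (hX _ h2), smul_zero]
      · rw [image_eq_zero_of_notMem_tsupport h1, zero_smul]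
    · exact localRep_apply_of_notMem A α X hyt

theorem hasCompactSupport_localRep {g : RiemMetric n M} {ι : Type v} (A : NormalCover g ι)
    (α : ι) (X : VectorFieldC n M) : HasCompactSupport (localRep A α X) := by
  obtain ⟨L, -, hL, h0⟩ := exists_isCompact_localRep_eq_zero A α X
  exact HasCompactSupport.intro hL h0

theorem contDiff_localRep {g : RiemMetric n M} {ι : Type v} (A : NormalCover g ι)
    (α : ι) (X : VectorFieldC n M) : ContDiff ℝ ∞ (localRep A α X) := by
  obtain ⟨L, hLt, hL, h0⟩ := exists_isCompact_localRep_eq_zero A α X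
  rw [contDiff_iff_contDiffAt]
  intro y
  by_cases hy : y ∈ L
  · have hmem := (A.chart α).open_target.mem_nhds (hLt hy)
    have h1 : ContDiffOn ℝ ∞ (fun y => A.partition α ((A.chart α).symm y) •
        chartField (A.chart α) X y) (A.chart α).target := by
      refine ContDiffOn.smul (𝕜 := ℝ) (𝕜' := ℝ) ?_ (contDiffOn_chartField (A.isNormal α).smooth X)
      rw [← contMDiffOn_iff_contDiffOn]
      exact (A.partition α).contMDiff.comp_contMDiffOn
        (contMDiffOn_symm_of_mem_maximalAtlas (A.isNormal α).smooth)
    refine (h1.contDiffAt hmem).congr_of_eventuallyEq ?_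
    filter_upwards [hmem] with z hz using localRep_apply_of_mem A α X hz
  · refine (contDiffAt_const (c := (0 : Euc n))).congr_of_eventuallyEq ?_
    filter_upwards [hL.isClosed.isOpen_compl.mem_nhds hy] with z hz using h0 z hz

theorem euclideanSobolevInner_self_nonneg (s : ℝ) (u : Euc n → Euc n) :
    0 ≤ euclideanSobolevInner s u u := by
  rw [euclideanSobolevInner_self]
  exact Finset.sum_nonneg fun _ _ => sobolevNormSq_nonneg _ _

/-- A compact set meets only finitely many supports of a locally finite family. Finiteness matters
because `finsum` over an infinite support is zero by default and would not dominate its terms. -/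
theorem finite_localRep_ne_zero {g : RiemMetric n M} {ι : Type v} (A : NormalCover g ι)
    (X : VectorFieldC n M) : {α | localRep A α X ≠ 0}.Finite := by
  obtain ⟨K, hK, hX⟩ := X.2
  refine (A.partition.locallyFinite.finite_nonempty_inter_compact hK).subset fun α hα => ?_
  obtain ⟨y, hy⟩ := Function.ne_iff.1 hα
  have hyt : y ∈ (A.chart α).target := by
    by_contra h
    exact hy (localRep_apply_of_notMem A α X h)
  rw [localRep_apply_of_mem A α X hyt] at hy
  refine ⟨(A.chart α).symm y, fun h => hy (by simp [h]), ?_⟩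
  by_contra h
  exact hy (by rw [chartField_eq_zero (hX _ h), smul_zero, Pi.zero_apply])

theorem euclideanSobolevInner_le_sobolevInner {g : RiemMetric n M} {ι : Type v}
    (A : NormalCover g ι) (s : ℝ) (X : VectorFieldC n M) (α : ι) :
    euclideanSobolevInner s (localRep A α X) (localRep A α X) ≤ sobolevInner A s X X := by
  refine single_le_finsum (f := fun β => euclideanSobolevInner s (localRep A β X)
    (localRep A β X)) α ((finite_localRep_ne_zero A X).subset fun β hβ h => hβ ?_)
    fun β => euclideanSobolevInner_self_nonneg s _
  simp only at hβ ⊢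
  rw [h]
  simp [euclideanSobolevInner, fourierT]

/-- The `k`-th component of `ρ_α X` in the normal coordinates, as a Schwartz function. -/
def localComponent {g : RiemMetric n M} {ι : Type v} (A : NormalCover g ι) (α : ι)
    (X : VectorFieldC n M) (k : Fin n) : SchwartzMap (Euc n) ℂ :=
  HasCompactSupport.toSchwartzMap (f := fun y => ((localRep A α X y k : ℝ) : ℂ))
    ((hasCompactSupport_localRep A α X).comp_left
      (g := fun v : Euc n => ((v k : ℝ) : ℂ)) (by simp))
    (Complex.ofRealCLM.contDiff.comp
      ((EuclideanSpace.proj (𝕜 := ℝ) k).contDiff.comp (contDiff_localRep A α X)))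

theorem localComponent_apply {g : RiemMetric n M} {ι : Type v} (A : NormalCover g ι) (α : ι)
    (X : VectorFieldC n M) (k : Fin n) (y : Euc n) :
    localComponent A α X k y = ((localRep A α X y k : ℝ) : ℂ) := rfl

theorem sobolevNormSq_localComponent_le {g : RiemMetric n M} {ι : Type v}
    (A : NormalCover g ι) (s : ℝ) (X : VectorFieldC n M) (α : ι) (k : Fin n) :
    sobolevNormSq s (localComponent A α X k) ≤ sobolevInner A s X X := by
  refine le_trans ?_ (euclideanSobolevInner_le_sobolevInner A s X α)
  rw [euclideanSobolevInner_self]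
  exact Finset.single_le_sum (f := fun k => sobolevNormSq s (fun y =>
    ((localRep A α X y k : ℝ) : ℂ))) (fun _ _ => sobolevNormSq_nonneg _ _) (Finset.mem_univ k)

/-! ### Smoothness of the inverse of a path of diffeomorphisms -/

namespace DiffPath

variable {φ₀ φ₁ : DiffC n M} (p : DiffPath φ₀ φ₁)

/-- The inverse diffeomorphisms of a path in `Diff_c(M)`. -/
def inverse (q : ℝ × M) : M := (p.toFun q.1).1.symm q.2

theorem apply_inverse (t : ℝ) (y : M) : (p.toFun t).1 (p.inverse (t, y)) = y :=
  (p.toFun t).1.apply_symm_apply y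

theorem inverse_apply (t : ℝ) (x : M) : p.inverse (t, (p.toFun t).1 x) = x :=
  (p.toFun t).1.symm_apply_apply x

/-- The map `F(t, x) = (t, φ_t(x))` is closed on the strip: it is the identity away from `K`, and
over `K` compactness applies. Preimages of closed sets under the inverse are images under `F`. -/
theorem continuousOn_inverse [T2Space M] :
    ContinuousOn p.inverse (Set.Icc (0 : ℝ) 1 ×ˢ Set.univ) := by
  obtain ⟨K, hK, hsupp⟩ := p.support
  set F : ℝ × M → ℝ × M := fun q => (q.1, (p.toFun q.1).1 q.2) with hF
  have hFc : ContinuousOn F (Set.Icc (0 : ℝ) 1 ×ˢ Set.univ) :=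
    continuousOn_fst.prodMk p.smooth.continuousOn
  rw [continuousOn_iff_isClosed]
  intro C hC
  refine ⟨F '' (Set.Icc (0 : ℝ) 1 ×ˢ C), ?_, ?_⟩
  · have hid : ∀ t ∈ Set.Icc (0 : ℝ) 1, ∀ x ∈ closure Kᶜ, (p.toFun t).1 x = x := fun t ht x hx =>
      Set.EqOn.closure (f := (p.toFun t).1) (g := id) (fun z hz => hsupp t ht z hz)
        (p.toFun t).1.continuous continuous_id hx
    -- The complement of `K` is replaced by its closure, where `φ_t` is still the identity by
    -- continuity, so that both pieces are closed.
    have hsplit : F '' (Set.Icc (0 : ℝ) 1 ×ˢ C) =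
        F '' (Set.Icc (0 : ℝ) 1 ×ˢ (K ∩ C)) ∪ Set.Icc (0 : ℝ) 1 ×ˢ (closure Kᶜ ∩ C) := by
      ext q
      constructor
      · rintro ⟨⟨t, x⟩, ⟨ht, hx⟩, rfl⟩
        by_cases hxK : x ∈ K
        · exact Or.inl ⟨(t, x), ⟨ht, hxK, hx⟩, rfl⟩
        · refine Or.inr ⟨ht, ?_⟩
          simp only [hF, hsupp t ht x hxK]
          exact ⟨subset_closure hxK, hx⟩
      · rintro (⟨⟨t, x⟩, ⟨ht, hx⟩, rfl⟩ | ⟨ht, hx⟩)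
        · exact ⟨(t, x), ⟨ht, hx.2⟩, rfl⟩
        · exact ⟨q, ⟨ht, hx.2⟩, Prod.ext rfl (hid _ ht _ hx.1)⟩
    rw [hsplit]
    refine IsClosed.union ?_ (isClosed_Icc.prod (isClosed_closure.inter hC))
    exact ((isCompact_Icc.prod (hK.inter_right hC)).image_of_continuousOn
      (hFc.mono (Set.prod_mono_right (Set.subset_univ _)))).isClosed
  · ext ⟨t, y⟩
    constructor
    · rintro ⟨hy, hs⟩
      exact ⟨⟨(t, p.inverse (t, y)), ⟨hs.1, hy⟩, Prod.ext rfl (p.apply_inverse t y)⟩, hs⟩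
    · rintro ⟨⟨⟨t', x⟩, ⟨ht, hx⟩, he⟩, hs⟩
      obtain ⟨rfl, rfl⟩ := Prod.ext_iff.1 he
      exact ⟨show p.inverse (t', (p.toFun t').1 x) ∈ C by rwa [p.inverse_apply], hs⟩

theorem mem_nhds_strip {t : ℝ} (ht : t ∈ Set.Ioo (0 : ℝ) 1) (x : M) :
    Set.Icc (0 : ℝ) 1 ×ˢ (Set.univ : Set M) ∈ 𝓝 (t, x) :=
  prod_mem_nhds (Icc_mem_nhds ht.1 ht.2) Filter.univ_mem

theorem contMDiffAt {t : ℝ} (ht : t ∈ Set.Ioo (0 : ℝ) 1) (x : M) :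
    ContMDiffAt (𝓘(ℝ, ℝ).prod (𝓡 n)) (𝓡 n) ∞
      (fun p' : ℝ × M => (p.toFun p'.1).1 p'.2) (t, x) :=
  p.smooth.contMDiffAt (mem_nhds_strip ht x)

/-- The inverse function theorem for `(t, z) ↦ (t, φ_t(z))` in charts. The derivative is block
triangular, so it is invertible once the spatial block is. -/
theorem contMDiffAt_inverse [T2Space M] {t₀ : ℝ} (ht : t₀ ∈ Set.Ioo (0 : ℝ) 1) (y₀ : M) :
    ContMDiffAt (𝓘(ℝ, ℝ).prod (𝓡 n)) (𝓡 n) ∞ p.inverse (t₀, y₀) := by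
  set x₀ := p.inverse (t₀, y₀) with hx₀
  set e := chartAt (Euc n) x₀
  set e' := chartAt (Euc n) y₀
  have hxs : x₀ ∈ e.source := mem_chart_source _ _
  have hys : y₀ ∈ e'.source := mem_chart_source _ _
  have he : ContMDiffOn (𝓡 n) (𝓡 n) ∞ e e.source := contMDiffOn_chart
  have hes : ContMDiffOn (𝓡 n) (𝓡 n) ∞ e.symm e.target := contMDiffOn_chart_symm
  have he' : ContMDiffOn (𝓡 n) (𝓡 n) ∞ e' e'.source := contMDiffOn_chart
  have hes' : ContMDiffOn (𝓡 n) (𝓡 n) ∞ e'.symm e'.target := contMDiffOn_chart_symm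
  have hφx : (p.toFun t₀).1 x₀ = y₀ := p.apply_inverse t₀ y₀
  have hesAt := hes.contMDiffAt (e.open_target.mem_nhds (e.map_source hxs))
  -- the diffeomorphisms in charts
  set f : ℝ × Euc n → Euc n := fun z => e' ((p.toFun z.1).1 (e.symm z.2)) with hf
  have hfs : ContDiffAt ℝ ∞ f (t₀, e x₀) := by
    rw [← contMDiffAt_iff_contDiffAt]
    have h1 : ContMDiffAt 𝓘(ℝ, ℝ × Euc n) (𝓘(ℝ, ℝ).prod (𝓡 n)) ∞
        (fun z : ℝ × Euc n => (z.1, e.symm z.2)) (t₀, e x₀) :=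
      contDiff_fst.contMDiff.contMDiffAt.prodMk
        (hesAt.comp (t₀, e x₀) contDiff_snd.contMDiff.contMDiffAt)
    have h2 : ContMDiffAt 𝓘(ℝ, ℝ × Euc n) (𝓡 n) ∞
        (fun z : ℝ × Euc n => (p.toFun z.1).1 (e.symm z.2)) (t₀, e x₀) := by
      refine ContMDiffAt.comp (I' := 𝓘(ℝ, ℝ).prod (𝓡 n))
        (g := fun q : ℝ × M => (p.toFun q.1).1 q.2) (t₀, e x₀) ?_ h1
      exact p.contMDiffAt ht _
    refine ContMDiffAt.comp (I' := 𝓡 n) (g := e') (t₀, e x₀) ?_ h2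
    refine he'.contMDiffAt (e'.open_source.mem_nhds ?_)
    simp only [e.left_inv hxs, hφx, hys]
  have hfx : f (t₀, e x₀) = e' y₀ := by simp only [hf, e.left_inv hxs, hφx]
  set F : ℝ × Euc n → ℝ × Euc n := fun z => (z.1, f z) with hF
  have hFs : ContDiffAt ℝ ∞ F (t₀, e x₀) := contDiffAt_fst.prodMk hfs
  have hFx : F (t₀, e x₀) = (t₀, e' y₀) := Prod.ext rfl hfx
  have hfd := (hfs.differentiableAt (by simp)).hasFDerivAt
  have hFd : HasFDerivAt F ((ContinuousLinearMap.fst ℝ ℝ (Euc n)).prod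
    (fderiv ℝ f (t₀, e x₀))) (t₀, e x₀) := hasFDerivAt_fst.prodMk hfd
  -- its spatial derivative is injective
  have hinj : ∀ v : Euc n, fderiv ℝ f (t₀, e x₀) (0, v) = 0 → v = 0 := by
    -- `φ_{t₀}⁻¹` in charts is a differentiable left inverse, so the chain rule gives the spatial
    -- derivative a left inverse.
    set k : Euc n → Euc n := fun y => e ((p.toFun t₀).1.symm (e'.symm y)) with hk
    have hks : ContDiffAt ℝ ∞ k (e' y₀) := by
      rw [← contMDiffAt_iff_contDiffAt]
      have h1 := hes'.contMDiffAt (e'.open_target.mem_nhds (e'.map_source hys))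
      have h2 := ContMDiffAt.comp (e' y₀) (p.toFun t₀).1.symm.contMDiff.contMDiffAt h1
      refine ContMDiffAt.comp (e' y₀) ?_ h2
      refine he.contMDiffAt (e.open_source.mem_nhds ?_)
      simp only [e'.left_inv hys]
      exact hxs
    have hkd := (hks.differentiableAt (by simp)).hasFDerivAt
    have hj : HasFDerivAt (fun z : Euc n => (t₀, z)) (ContinuousLinearMap.inr ℝ ℝ (Euc n)) (e x₀) :=
      hasFDerivAt_prodMk_right t₀ (e x₀)
    have hfz : HasFDerivAt (fun z : Euc n => f (t₀, z)) _ (e x₀) := hfd.comp (e x₀) hj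
    rw [← hfx] at hkd
    have hcomp : HasFDerivAt (fun z => k (f (t₀, z))) _ (e x₀) :=
      HasFDerivAt.comp (g := k) (f := fun z => f (t₀, z)) (e x₀) hkd hfz
    have hid : (fun z => k (f (t₀, z))) =ᶠ[𝓝 (e x₀)] id := by
      have hc : ContinuousAt (fun z => (p.toFun t₀).1 (e.symm z)) (e x₀) :=
        (p.toFun t₀).1.continuous.continuousAt.comp hesAt.continuousAt
      have h1 : ∀ᶠ z in 𝓝 (e x₀), (p.toFun t₀).1 (e.symm z) ∈ e'.source :=
        hc.eventually_mem (e'.open_source.mem_nhds (by simp only [e.left_inv hxs, hφx, hys]))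
      filter_upwards [h1, e.open_target.mem_nhds (e.map_source hxs)] with z hz1 hz2
      simp only [hk, hf, e'.left_inv hz1, Diffeomorph.symm_apply_apply, e.right_inv hz2, id]
    have huniq := (hcomp.congr_of_eventuallyEq hid.symm).unique (hasFDerivAt_id (e x₀))
    intro v hv
    have := congrArg (fun L : Euc n →L[ℝ] Euc n => L v) huniq
    simp only [ContinuousLinearMap.comp_apply, ContinuousLinearMap.inr_apply, hv, map_zero,
      ContinuousLinearMap.id_apply] at this
    exact this.symm
  set F' := (ContinuousLinearMap.fst ℝ ℝ (Euc n)).prod (fderiv ℝ f (t₀, e x₀)) with hF'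
  have hF'inj : Function.Injective (F' : ℝ × Euc n →ₗ[ℝ] ℝ × Euc n) := by
    rw [injective_iff_map_eq_zero]
    rintro ⟨τ, v⟩ h
    have h1 : τ = 0 := congrArg Prod.fst h
    subst h1
    have h2 : fderiv ℝ f (t₀, e x₀) (0, v) = 0 := congrArg Prod.snd h
    rw [hinj v h2]
    rfl
  set L := (LinearEquiv.ofInjectiveEndo _ hF'inj).toContinuousLinearEquiv with hL
  have hLF : (L : ℝ × Euc n →L[ℝ] ℝ × Euc n) = F' := by
    ext z <;> rfl
  rw [← hLF] at hFd
  set G := hFs.localInverse hFd (by simp) with hG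
  have hGs : ContDiffAt ℝ ∞ G (t₀, e' y₀) := hFx ▸ hFs.to_localInverse hFd (by simp)
  have hGx : G (t₀, e' y₀) = (t₀, e x₀) := hFx ▸ hFs.localInverse_apply_image hFd (by simp)
  have hGleft : ∀ᶠ z in 𝓝 (t₀, e x₀), G (F z) = z :=
    (hFs.hasStrictFDerivAt' hFd (by simp)).eventually_left_inverse
  have hic : ContinuousAt p.inverse (t₀, y₀) :=
    p.continuousOn_inverse.continuousAt (mem_nhds_strip ht y₀)
  have hec : ContinuousAt (fun q : ℝ × M => (q.1, e (p.inverse q))) (t₀, y₀) :=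
    continuousAt_fst.prodMk
      (ContinuousAt.comp (f := p.inverse) (e.continuousAt hxs) hic)
  -- The continuity already proved keeps `φ_t⁻¹(y)` in the region where `G` inverts `F`; this
  -- identifies the local inverse with the global one.
  have hev : p.inverse =ᶠ[𝓝 (t₀, y₀)] fun q => e.symm (G (q.1, e' q.2)).2 := by
    filter_upwards [hec.eventually hGleft, hic.eventually_mem (e.open_source.mem_nhds hxs)]
      with q hq1 hq2
    have h1 : F (q.1, e (p.inverse q)) = (q.1, e' q.2) := by
      simp only [hF, hf, e.left_inv hq2]
      rw [show (p.toFun q.1).1 (p.inverse q) = q.2 from p.apply_inverse q.1 q.2]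
    rw [h1] at hq1
    simp only [hq1, e.left_inv hq2]
  refine ContMDiffAt.congr_of_eventuallyEq ?_ hev
  have h1 : ContMDiffAt (𝓘(ℝ, ℝ).prod (𝓡 n)) 𝓘(ℝ, ℝ × Euc n) ∞
      (fun q : ℝ × M => (q.1, e' q.2)) (t₀, y₀) := by
    refine ContMDiffAt.prodMk_space contMDiffAt_fst ?_
    exact ContMDiffAt.comp (t₀, y₀) (he'.contMDiffAt (e'.open_source.mem_nhds hys)) contMDiffAt_snd
  have h2 : ContMDiffAt (𝓘(ℝ, ℝ).prod (𝓡 n)) (𝓡 n) ∞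
      (fun q : ℝ × M => (G (q.1, e' q.2)).2) (t₀, y₀) :=
    ContMDiffAt.comp (I' := 𝓘(ℝ, ℝ × Euc n)) (g := fun z => (G z).2) (t₀, y₀)
      (contDiffAt_snd.comp _ hGs).contMDiffAt h1
  refine ContMDiffAt.comp (t₀, y₀) ?_ h2
  rw [hGx]
  exact hesAt

end DiffPath

/-! ### A lower bound for the length of a path -/

/-- The fundamental theorem of calculus needs an integrable derivative; if it is not integrable the
right side is infinite. -/
theorem ofReal_abs_sub_le_lintegral_deriv {Φ : ℝ → ℝ} (hc : ContinuousOn Φ (Set.Icc 0 1))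
    (hd : ∀ t ∈ Set.Ioo (0 : ℝ) 1, DifferentiableAt ℝ Φ t) :
    ENNReal.ofReal |Φ 1 - Φ 0| ≤ ∫⁻ t in Set.Icc (0 : ℝ) 1, ‖deriv Φ t‖ₑ := by
  by_cases hfin : ∫⁻ t in Set.Icc (0 : ℝ) 1, ‖deriv Φ t‖ₑ = ⊤
  · rw [hfin]
    exact le_top
  have hint : IntegrableOn (deriv Φ) (Set.Icc 0 1) :=
    ⟨(measurable_deriv Φ).aestronglyMeasurable, lt_top_iff_ne_top.2 hfin⟩
  have hftc := intervalIntegral.integral_eq_sub_of_hasDerivAt_of_le zero_le_one hc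
    (fun t ht => (hd t ht).hasDerivAt)
    ((intervalIntegrable_iff_integrableOn_Icc_of_le zero_le_one).2 hint)
  rw [← hftc, intervalIntegral.integral_of_le zero_le_one, ← integral_Icc_eq_integral_Ioc,
    ← Real.norm_eq_abs, ofReal_norm]
  exact enorm_integral_le_lintegral_enorm _

/-- If along every path from `φ₀` to `φ₁` some function changes at least by `c > 0` while its
derivative is controlled by the Sobolev norm of the velocity, then the distance is positive. -/
theorem geodesicDist_pos {g : RiemMetric n M} {ι : Type v} {A : NormalCover g ι} {s : ℝ}
    {B : VectorFieldC n M → VectorFieldC n M → ℝ} (hB : IsEquivToSobolev A s B)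
    {φ₀ φ₁ : DiffC n M} {c C : ℝ} (hc : 0 < c)
    (h : ∀ p : DiffPath φ₀ φ₁, ∃ Φ : ℝ → ℝ, ContinuousOn Φ (Set.Icc 0 1) ∧
      (∀ t ∈ Set.Ioo (0 : ℝ) 1, DifferentiableAt ℝ Φ t ∧
        |deriv Φ t| ≤ C * √(sobolevInner A s (p.velocity t) (p.velocity t))) ∧
      c ≤ |Φ 1 - Φ 0|) :
    0 < geodesicDist B φ₀ φ₁ := by
  obtain ⟨D, hD, hDB⟩ := hB
  set E : ℝ≥0∞ := ENNReal.ofReal (|C| * √D)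
  have hE : E ≠ ⊤ := ENNReal.ofReal_ne_top
  -- The uniform lower bound is `c / E`, where `√D` accounts for passing from `B` to the Sobolev
  -- norm. Division in `ℝ≥0∞` covers `E = 0`.
  refine lt_of_lt_of_le (ENNReal.div_pos (b := E) (ENNReal.ofReal_pos.2 hc).ne' hE)
    (le_iInf fun p => ENNReal.div_le_of_le_mul' ?_)
  obtain ⟨Φ, hΦc, hΦd, hΦ⟩ := h p
  calc ENNReal.ofReal c ≤ ENNReal.ofReal |Φ 1 - Φ 0| := ENNReal.ofReal_le_ofReal hΦ
    _ ≤ ∫⁻ t in Set.Icc (0 : ℝ) 1, ‖deriv Φ t‖ₑ :=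
      ofReal_abs_sub_le_lintegral_deriv hΦc fun t ht => (hΦd t ht).1
    _ = ∫⁻ t in Set.Ioo (0 : ℝ) 1, ‖deriv Φ t‖ₑ := by
      rw [setLIntegral_congr Ioo_ae_eq_Icc]
    _ ≤ ∫⁻ t in Set.Ioo (0 : ℝ) 1, E *
        ENNReal.ofReal (√(B (p.velocity t) (p.velocity t))) := by
      refine setLIntegral_mono' measurableSet_Ioo fun t ht => ?_
      rw [← ENNReal.ofReal_mul (by positivity), ← ofReal_norm, Real.norm_eq_abs]
      refine ENNReal.ofReal_le_ofReal ((hΦd t ht).2.trans ?_)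
      rw [mul_assoc, ← Real.sqrt_mul hD.le]
      refine mul_le_mul (le_abs_self C) (Real.sqrt_le_sqrt ?_) (Real.sqrt_nonneg _)
        (abs_nonneg C)
      have := mul_le_mul_of_nonneg_left (hDB (p.velocity t)).1 hD.le
      rwa [mul_inv_cancel_left₀ hD.ne'] at this
    _ ≤ ∫⁻ t in Set.Icc (0 : ℝ) 1, E *
        ENNReal.ofReal (√(B (p.velocity t) (p.velocity t))) :=
      lintegral_mono_set Set.Ioo_subset_Icc_self
    _ = E * p.length B := lintegral_const_mul' _ _ hE

/-! ### The weak divergence estimate -/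

/-- Transported functions are regular only on the chart target; a factor supported there makes the
product globally continuous. -/
theorem continuous_mul_of_tsupport_subset {X : Type*} [TopologicalSpace X] {f ζ : X → ℝ}
    {V : Set X} (hV : IsOpen V) (hf : ContinuousOn f V) (hζ : Continuous ζ)
    (hζV : tsupport ζ ⊆ V) : Continuous fun x => f x * ζ x :=
  continuous_of_tsupport fun _ hx =>
    (hf.continuousAt (hV.mem_nhds (hζV (tsupport_mul_subset_right hx)))).mul hζ.continuousAt

theorem integrable_mul_of_tsupport_subset {f ζ : Euc n → ℝ}
    {V : Set (Euc n)} (hV : IsOpen V) (hf : ContinuousOn f V) (hζ : Continuous ζ)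
    (hζc : HasCompactSupport ζ) (hζV : tsupport ζ ⊆ V) : Integrable fun x => f x * ζ x :=
  (continuous_mul_of_tsupport_subset hV hf hζ hζV).integrable_of_hasCompactSupport hζc.mul_left

/-- Integration by parts removes the derivative from `h`, of which only `|h| ≤ 1` is then used.
Cauchy-Schwarz on the two terms of `∂_e(ζ w)` leaves a constant depending on `ζ` and `e` alone. -/
theorem abs_integral_mul_fderiv_le {s : ℝ} (hs : 1 ≤ s) {ζ h w : Euc n → ℝ} {V : Set (Euc n)}
    (hζ : ContDiff ℝ ∞ ζ) (hζc : HasCompactSupport ζ) (hV : IsOpen V) (hζV : tsupport ζ ⊆ V)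
    (hh : ContDiffOn ℝ 1 h V) (hb : ∀ y, |h y| ≤ 1) {F : SchwartzMap (Euc n) ℂ}
    (hF : ∀ y, F y = ((w y : ℝ) : ℂ)) {e : Euc n} (he : ‖e‖ ≤ 1) :
    |∫ y, fderiv ℝ h y e * (ζ y * w y)| ≤
      (√(∫ y, ‖fderiv ℝ ζ y e‖ ^ 2) + √(∫ y, ‖ζ y‖ ^ 2)) * √(sobolevNormSq s F) := by
  have hw : ContDiff ℝ ∞ w := by
    have : w = fun y => Complex.reCLM (F y) := by ext y; simp [hF]
    rw [this]
    exact Complex.reCLM.contDiff.comp (F.smooth ⊤)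
  have hζw : ContDiff ℝ ∞ fun y => ζ y * w y := hζ.mul hw
  have hζwc : HasCompactSupport fun y => ζ y * w y := hζc.mul_right
  have hζwV : tsupport (fun y => ζ y * w y) ⊆ V :=
    (closure_mono (Function.support_mul_subset_left ζ w)).trans hζV
  have hdc : ∀ {k : Euc n → ℝ}, ContDiff ℝ ∞ k → Continuous fun y => fderiv ℝ k y e := fun hk =>
    (hk.continuous_fderiv (by simp)).clm_apply continuous_const
  have hdV : tsupport (fun y => fderiv ℝ (fun y => ζ y * w y) y e) ⊆ V :=
    (tsupport_fderiv_apply_subset ℝ e).trans hζwV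
  have hdcs : HasCompactSupport fun y => fderiv ℝ (fun y => ζ y * w y) y e :=
    hζwc.fderiv_apply ℝ e
  have hhd : ∀ y ∈ tsupport (fun y => ζ y * w y), DifferentiableAt ℝ h y := fun y hy =>
    (hh.contDiffAt (hV.mem_nhds (hζwV hy))).differentiableAt (by simp)
  have hhc : ContinuousOn (fun y => fderiv ℝ h y e) V :=
    (hh.continuousOn_fderiv_of_isOpen hV (by simp)).clm_apply continuousOn_const
  have hparts := integral_mul_fderiv_eq_neg_fderiv_mul_of_integrable (μ := volume) (v := e)
    (integrable_mul_of_tsupport_subset hV hhc hζw.continuous hζwc hζwV)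
    (integrable_mul_of_tsupport_subset hV hh.continuousOn (hdc hζw) hdcs hdV)
    (integrable_mul_of_tsupport_subset hV hh.continuousOn hζw.continuous hζwc hζwV)
    hhd (fun y _ => hζw.differentiable (by simp) y)
  rw [← abs_neg, ← hparts]
  have hFd : ∀ y, ‖fderiv ℝ F y e‖ = ‖fderiv ℝ w y e‖ := fun y => by
    have h1 : HasFDerivAt F (Complex.ofRealCLM.comp (fderiv ℝ w y)) y := by
      have : (F : Euc n → ℂ) = fun y => Complex.ofRealCLM (w y) := by ext y; simp [hF]
      rw [this]
      exact Complex.ofRealCLM.hasFDerivAt.comp y (hw.differentiable (by simp) y).hasFDerivAt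
    rw [h1.fderiv]
    simp
  have hFl : ∀ y, LineDeriv.lineDerivOp e F y = fderiv ℝ F y e := fun y =>
    SchwartzMap.lineDerivOp_apply_eq_fderiv e F y
  have hm1 : MemLp (fun y => ‖fderiv ℝ ζ y e‖) 2 :=
    ((hdc hζ).memLp_of_hasCompactSupport (hζc.fderiv_apply ℝ e)).norm
  have hm2 : MemLp (fun y => ‖ζ y‖) 2 := (hζ.continuous.memLp_of_hasCompactSupport hζc).norm
  have hm3 : MemLp (fun y => ‖F y‖) 2 := (F.memLp 2).norm
  have hm4 : MemLp (fun y => ‖fderiv ℝ F y e‖) 2 := by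
    have := ((LineDeriv.lineDerivOp e F).memLp 2 (volume : Measure (Euc n))).norm
    simpa only [hFl] using this
  have hi1 : Integrable fun y => ‖fderiv ℝ ζ y e‖ * ‖F y‖ := hm1.integrable_mul hm3
  have hi2 : Integrable fun y => ‖ζ y‖ * ‖fderiv ℝ F y e‖ := hm2.integrable_mul hm4
  calc |∫ y, h y * fderiv ℝ (fun y => ζ y * w y) y e|
      ≤ ∫ y, (‖fderiv ℝ ζ y e‖ * ‖F y‖ + ‖ζ y‖ * ‖fderiv ℝ F y e‖) := by
        rw [← Real.norm_eq_abs]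
        refine norm_integral_le_of_norm_le (hi1.add hi2) (.of_forall fun y => ?_)
        have h1 : fderiv ℝ (fun y => ζ y * w y) y e =
            ζ y * fderiv ℝ w y e + fderiv ℝ ζ y e * w y := by
          rw [fderiv_fun_mul (hζ.differentiable (by simp) y) (hw.differentiable (by simp) y)]
          simp [mul_comm]
        rw [h1, norm_mul, hF, Complex.norm_real, hFd, add_comm (_ * _) (‖ζ y‖ * _),
          ← norm_mul (ζ y), ← norm_mul (fderiv ℝ ζ y e)]
        exact (mul_le_of_le_one_left (norm_nonneg _) (hb y)).trans (norm_add_le _ _)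
    _ = (∫ y, ‖fderiv ℝ ζ y e‖ * ‖F y‖) + ∫ y, ‖ζ y‖ * ‖fderiv ℝ F y e‖ :=
        integral_add hi1 hi2
    _ ≤ √(∫ y, ‖fderiv ℝ ζ y e‖ ^ 2) * √(sobolevNormSq s F) +
        √(∫ y, ‖ζ y‖ ^ 2) * √(sobolevNormSq s F) := by
        refine add_le_add ?_ ?_
        · refine (integral_mul_le_sqrt_mul_sqrt (fun _ => norm_nonneg _) (fun _ => norm_nonneg _)
            hm1 hm3).trans (mul_le_mul_of_nonneg_left (Real.sqrt_le_sqrt ?_) (Real.sqrt_nonneg _))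
          exact integral_norm_sq_le_sobolevNormSq (by linarith) F
        · refine (integral_mul_le_sqrt_mul_sqrt (fun _ => norm_nonneg _) (fun _ => norm_nonneg _)
            hm2 hm4).trans (mul_le_mul_of_nonneg_left (Real.sqrt_le_sqrt ?_) (Real.sqrt_nonneg _))
          exact integral_norm_sq_fderiv_le_sobolevNormSq hs F he
    _ = _ := (add_mul _ _ _).symm

/-- A vector field on `ℝⁿ` multiplied with a test function `ζ` has a divergence whose `L¹` norm is
controlled by the `H^s` norm, `s ≥ 1`; here tested against bounded functions `h`. -/
theorem exists_abs_integral_fderiv_le {s : ℝ} (hs : 1 ≤ s) {ζ : Euc n → ℝ} {V : Set (Euc n)}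
    (hζ : ContDiff ℝ ∞ ζ) (hζc : HasCompactSupport ζ) (hV : IsOpen V) (hζV : tsupport ζ ⊆ V) :
    ∃ C : ℝ, 0 ≤ C ∧ ∀ (h : Euc n → ℝ) (w : Euc n → Euc n) (F : Fin n → SchwartzMap (Euc n) ℂ)
      (N : ℝ), ContDiffOn ℝ 1 h V → (∀ y, |h y| ≤ 1) → (∀ k y, F k y = ((w y k : ℝ) : ℂ)) →
      (∀ k, √(sobolevNormSq s (F k)) ≤ N) → |∫ y, ζ y * fderiv ℝ h y (w y)| ≤ C * N := by
  set b := EuclideanSpace.basisFun (Fin n) ℝ with hbdef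
  set c : Fin n → ℝ := fun k =>
    √(∫ y, ‖fderiv ℝ ζ y (b k)‖ ^ 2) + √(∫ y, ‖ζ y‖ ^ 2) with hc
  have hc0 : ∀ k, 0 ≤ c k := fun k => by simp only [hc]; positivity
  refine ⟨∑ k, c k, Finset.sum_nonneg fun k _ => hc0 k, fun h w F N hh hb hF hN => ?_⟩
  have hw : ∀ k, Continuous fun y => w y k := fun k => by
    have : (fun y => w y k) = fun y => (F k y).re := by ext y; simp [hF]
    rw [this]
    exact Complex.continuous_re.comp (F k).continuous
  have hhc : ∀ k, ContinuousOn (fun y => fderiv ℝ h y (b k)) V := fun k =>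
    (hh.continuousOn_fderiv_of_isOpen hV (by simp)).clm_apply continuousOn_const
  have hi : ∀ k ∈ Finset.univ, Integrable fun y => fderiv ℝ h y (b k) * (ζ y * w y k) :=
    fun k _ => integrable_mul_of_tsupport_subset hV (hhc k) (hζ.continuous.mul (hw k))
      hζc.mul_right ((closure_mono (Function.support_mul_subset_left ζ _)).trans hζV)
  have hsum : ∀ y, ζ y * fderiv ℝ h y (w y) = ∑ k, fderiv ℝ h y (b k) * (ζ y * w y k) := by
    intro y
    conv_lhs => rw [← b.sum_repr (w y)]
    rw [map_sum, Finset.mul_sum]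
    refine Finset.sum_congr rfl fun k _ => ?_
    rw [map_smul, smul_eq_mul]
    simp only [hbdef, EuclideanSpace.basisFun_repr]
    ring
  simp_rw [hsum]
  rw [integral_finsetSum _ hi, Finset.sum_mul]
  refine (Finset.abs_sum_le_sum_abs _ _).trans (Finset.sum_le_sum fun k _ => ?_)
  refine (abs_integral_mul_fderiv_le hs hζ hζc hV hζV hh hb (hF k)
    (b.orthonormal.1 k).le).trans (mul_le_mul_of_nonneg_left (hN k) (hc0 k))

/-! ### Trajectories of a path of diffeomorphisms -/

namespace DiffPath

variable {φ₀ φ₁ : DiffC n M} (p : DiffPath φ₀ φ₁)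

theorem contMDiffAt_trajectory {t : ℝ} (ht : t ∈ Set.Ioo (0 : ℝ) 1) (x : M) :
    ContMDiffAt 𝓘(ℝ, ℝ) (𝓡 n) ∞ (fun τ => (p.toFun τ).1 x) t :=
  ContMDiffAt.comp (I' := 𝓘(ℝ, ℝ).prod (𝓡 n)) (g := fun q : ℝ × M => (p.toFun q.1).1 q.2)
    (f := fun τ => (τ, x)) t (p.contMDiffAt ht x) (contMDiffAt_id.prodMk contMDiffAt_const)

theorem continuousOn_trajectory (x : M) :
    ContinuousOn (fun τ => (p.toFun τ).1 x) (Set.Icc 0 1) :=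
  p.smooth.continuousOn.comp (f := fun τ => (τ, x)) (by fun_prop) fun τ hτ => ⟨hτ, trivial⟩

theorem hasDerivAt_chart_trajectory {κ : OpenPartialHomeomorph M (Euc n)}
    (hκ : κ ∈ IsManifold.maximalAtlas (𝓡 n) ∞ M) {t : ℝ} (ht : t ∈ Set.Ioo (0 : ℝ) 1) {x : M}
    (hx : (p.toFun t).1 x ∈ κ.source) :
    HasDerivAt (fun τ => κ ((p.toFun τ).1 x))
      (chartField κ (p.velocity t) (κ ((p.toFun t).1 x))) t := by
  have h1 := ((p.contMDiffAt_trajectory ht x).mdifferentiableAt (by simp)).hasMFDerivAt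
  have h2 := (((contMDiffOn_of_mem_maximalAtlas hκ).contMDiffAt
    (κ.open_source.mem_nhds hx)).mdifferentiableAt (by simp)).hasMFDerivAt
  have h3 := (HasMFDerivAt.comp t h2 h1).hasFDerivAt
  set L : ℝ →L[ℝ] Euc n := (mfderiv (𝓡 n) (𝓡 n) κ ((p.toFun t).1 x)).comp
    (mfderiv 𝓘(ℝ, ℝ) (𝓡 n) (fun τ => (p.toFun τ).1 x) t) with hL
  have h4 : HasFDerivAt (fun τ => κ ((p.toFun τ).1 x)) L t := h3
  have hv := p.velocity_eq t (Set.Ioo_subset_Icc_self ht) x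
  -- At interior times the derivative within `[0,1]` is the ordinary one.
  rw [mfderivWithin_of_mem_nhds (Icc_mem_nhds ht.1 ht.2)] at hv
  have h5 : chartField κ (p.velocity t) (κ ((p.toFun t).1 x)) = L 1 := by
    unfold chartField
    rw [κ.left_inv hx]
    exact (congrArg (mfderiv (𝓡 n) (𝓡 n) κ ((p.toFun t).1 x)) hv).symm
  rw [h5]
  exact h4.hasDerivAt

end DiffPath

/-! ### Positivity above the Sobolev embedding threshold -/

theorem norm_le_of_forall_abs_le {v : Euc n} {c : ℝ} (h : ∀ k, |v k| ≤ c) :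
    ‖v‖ ≤ n * c := by
  conv_lhs => rw [← (EuclideanSpace.basisFun (Fin n) ℝ).sum_repr v]
  refine (norm_sum_le _ _).trans ?_
  refine (Finset.sum_le_card_nsmul _ _ c fun k _ => ?_).trans_eq (by simp)
  rw [norm_smul, (EuclideanSpace.basisFun (Fin n) ℝ).orthonormal.1 k, mul_one]
  exact h k

theorem exists_norm_localRep_le {g : RiemMetric n M} {ι : Type v} (A : NormalCover g ι) {s : ℝ}
    (hs : (n : ℝ) / 2 < s) (α : ι) :
    ∃ C : ℝ, 0 ≤ C ∧ ∀ (X : VectorFieldC n M) (y : Euc n),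
      ‖localRep A α X y‖ ≤ C * √(sobolevInner A s X X) := by
  obtain ⟨C, hC, h⟩ := exists_norm_le_sqrt_sobolevNormSq hs
  refine ⟨n * C, by positivity, fun X y => ?_⟩
  rw [mul_assoc]
  refine norm_le_of_forall_abs_le fun k => ?_
  have h1 := h (localComponent A α X k) y
  rw [localComponent_apply, Complex.norm_real, Real.norm_eq_abs] at h1
  exact h1.trans (mul_le_mul_of_nonneg_left
    (Real.sqrt_le_sqrt (sobolevNormSq_localComponent_le A s X α k)) hC)

/-- Around each point there is a normal chart of the cover and an open set in it on which the
function of the partition of unity is positive. -/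
theorem exists_chart_partition_pos {g : RiemMetric n M} {ι : Type v} (A : NormalCover g ι) (x : M) :
    ∃ α, x ∈ (A.chart α).source ∧
      ∃ V ⊆ (A.chart α).target, IsOpen V ∧ A.chart α x ∈ V ∧
        (∀ y ∈ V, 0 < A.partition α ((A.chart α).symm y)) := by
  obtain ⟨α, hα⟩ := A.partition.exists_pos_of_mem (Set.mem_univ x)
  have hx : x ∈ (A.chart α).source :=
    A.subordinate α (subset_tsupport _ hα.ne')
  refine ⟨α, hx, _, Set.inter_subset_left, (A.chart α).symm.isOpen_inter_preimage
    (isOpen_lt continuous_const (A.partition α).contMDiff.continuous), ?_, fun y hy => hy.2⟩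
  exact ⟨(A.chart α).map_source hx, by
    simpa only [Set.mem_preimage, Set.mem_ofPred_eq, (A.chart α).left_inv hx] using hα⟩

/-- The observed quantity is `f(φ_t(x))`, for a bump `f` equal to one at `φ₀(x)` and zero at
`φ₁(x)`. The support of `f` is confined to a ball in one chart where `ρ_α > 0`, since the path may
leave that chart. -/
theorem geodesicDist_pos_of_lt [T2Space M] [SigmaCompactSpace M]
    {g : RiemMetric n M} {ι : Type v} (A : NormalCover g ι) {s : ℝ} (hs : (n : ℝ) / 2 < s)
    {B : VectorFieldC n M → VectorFieldC n M → ℝ} (hB : IsEquivToSobolev A s B)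
    {φ₀ φ₁ : DiffC n M} (hφ : φ₀ ≠ φ₁) : 0 < geodesicDist B φ₀ φ₁ := by
  obtain ⟨x, hx⟩ : ∃ x, φ₀.1 x ≠ φ₁.1 x := by
    by_contra! h
    exact hφ (Subtype.ext (Diffeomorph.ext h))
  obtain ⟨α, hxs, V, hVt, hV, hxV, hpos⟩ := exists_chart_partition_pos A (φ₀.1 x)
  obtain ⟨C₁, hC₁, hw⟩ := exists_norm_localRep_le A hs α
  set κ := A.chart α with hκdef
  have hκ : κ ∈ IsManifold.maximalAtlas (𝓡 n) ∞ M := (A.isNormal α).smooth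
  obtain ⟨r, hr, hrV⟩ := Metric.nhds_basis_closedBall.mem_iff.1 (hV.mem_nhds hxV)
  set O : Set M := κ.source ∩ κ ⁻¹' Metric.ball (κ (φ₀.1 x)) r ∩ {φ₁.1 x}ᶜ
  have hO : IsOpen O := (κ.isOpen_inter_preimage Metric.isOpen_ball).inter isOpen_compl_singleton
  obtain ⟨f, hf0, hf1, hf⟩ := exists_contMDiffMap_zero_one_of_isClosed (n := ⊤) (𝓡 n)
    hO.isClosed_compl (isClosed_singleton (x := φ₀.1 x))
    (Set.disjoint_singleton_right.2 fun h => h ⟨⟨hxs, Metric.mem_ball_self hr⟩, hx⟩)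
  have hfs : ContMDiff (𝓡 n) 𝓘(ℝ, ℝ) ∞ f := f.contMDiff
  set fκ : Euc n → ℝ := fun y => f (κ.symm y) with hfκ
  have hfκs : ContDiffOn ℝ ∞ fκ κ.target := by
    rw [← contMDiffOn_iff_contDiffOn]
    exact hfs.comp_contMDiffOn (contMDiffOn_symm_of_mem_maximalAtlas hκ)
  have hρc : ContinuousOn (fun y => A.partition α (κ.symm y)) V :=
    (A.partition α).contMDiff.continuous.comp_continuousOn (κ.continuousOn_symm.mono hVt)
  -- The Sobolev embedding bounds `ρ_α u`, not `u`, so the missing factor `1/ρ_α` is absorbed into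
  -- `df`.
  obtain ⟨C₂, hC₂⟩ := (isCompact_closedBall (κ (φ₀.1 x)) r).exists_bound_of_continuousOn
    (f := fun y => (A.partition α (κ.symm y))⁻¹ • fderiv ℝ fκ y)
    (((hρc.mono hrV).inv₀ fun y hy => (hpos y (hrV hy)).ne').smul
      ((hfκs.continuousOn_fderiv_of_isOpen κ.open_target (by simp)).mono (hrV.trans hVt)))
  have hC₂0 : 0 ≤ C₂ := (norm_nonneg _).trans (hC₂ _ (Metric.mem_closedBall_self hr.le))
  refine geodesicDist_pos (c := 1) (C := C₂ * C₁) hB one_pos fun p =>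
    ⟨fun t => f ((p.toFun t).1 x), hfs.continuous.comp_continuousOn (p.continuousOn_trajectory x),
      fun t ht => ?_, ?_⟩
  · have hd : DifferentiableAt ℝ (fun t => f ((p.toFun t).1 x)) t :=
      (ContMDiffAt.comp t hfs.contMDiffAt
        (p.contMDiffAt_trajectory ht x)).contDiffAt.differentiableAt (by simp)
    refine ⟨hd, ?_⟩
    by_cases hy : (p.toFun t).1 x ∈ O
    · have hys := hy.1.1
      set y := κ ((p.toFun t).1 x) with hydef
      have hyb : y ∈ Metric.closedBall (κ (φ₀.1 x)) r := Metric.ball_subset_closedBall hy.1.2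
      have hyt : y ∈ κ.target := κ.map_source hys
      have h1 := p.hasDerivAt_chart_trajectory hκ ht hys
      have h2 : HasFDerivAt fκ (fderiv ℝ fκ y) y :=
        ((hfκs.contDiffAt (κ.open_target.mem_nhds hyt)).differentiableAt (by simp)).hasFDerivAt
      have h3 : (fun τ => f ((p.toFun τ).1 x)) =ᶠ[𝓝 t] fun τ => fκ (κ ((p.toFun τ).1 x)) := by
        filter_upwards [(p.contMDiffAt_trajectory ht x).continuousAt.eventually_mem
          (κ.open_source.mem_nhds hys)] with τ hτ
        simp only [hfκ, κ.left_inv hτ]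
      have h5 : HasDerivAt (fun τ => fκ (κ ((p.toFun τ).1 x)))
          (fderiv ℝ fκ y (chartField κ (p.velocity t) y)) t :=
        HasFDerivAt.comp_hasDerivAt (f := fun τ => κ ((p.toFun τ).1 x)) t h2 h1
      rw [h3.deriv_eq, h5.deriv]
      have hρ := hpos y (hrV hyb)
      have h4 : chartField κ (p.velocity t) y =
          (A.partition α (κ.symm y))⁻¹ • localRep A α (p.velocity t) y := by
        rw [localRep_apply_of_mem A α _ hyt, inv_smul_smul₀ hρ.ne']
      rw [h4, map_smul, ← smul_apply, mul_assoc]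
      exact (((A.partition α (κ.symm y))⁻¹ • fderiv ℝ fκ y).le_opNorm _).trans
        (mul_le_mul (hC₂ y hyb) (hw _ y) (norm_nonneg _) hC₂0)
    -- Outside `O` the velocity is not controlled, but `f` attains its minimum zero there, which
    -- forces the derivative to vanish.
    · have hmin : IsLocalMin (fun t => f ((p.toFun t).1 x)) t :=
        Filter.Eventually.of_forall fun τ => (hf0 hy).trans_le (hf _).1
      rw [hmin.deriv_eq_zero, abs_zero]
      positivity
  · have h1 : f ((p.toFun 1).1 x) = 0 := by
      rw [p.target]
      exact hf0 fun h => h.2 rfl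
    have h0 : f ((p.toFun 0).1 x) = 1 := by
      rw [p.source]
      exact hf1 rfl
    simp [h0, h1]

/-! ### The transport equation -/

namespace DiffPath

variable {φ₀ φ₁ : DiffC n M} (p : DiffPath φ₀ φ₁)

/-- The function `f` transported along the path, in the chart `κ`: `(t, y) ↦ f (φ_t⁻¹ (κ⁻¹ y))`. -/
def transport (f : M → ℝ) (κ : OpenPartialHomeomorph M (Euc n)) (q : ℝ × Euc n) : ℝ :=
  f (p.inverse (q.1, κ.symm q.2))

variable {f : M → ℝ} {κ : OpenPartialHomeomorph M (Euc n)}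

theorem continuousOn_transport [T2Space M] (hf : ContMDiff (𝓡 n) 𝓘(ℝ, ℝ) ∞ f) :
    ContinuousOn (p.transport f κ) (Set.Icc 0 1 ×ˢ κ.target) :=
  hf.continuous.comp_continuousOn (p.continuousOn_inverse.comp
    (f := fun q : ℝ × Euc n => (q.1, κ.symm q.2))
    (continuousOn_fst.prodMk (κ.continuousOn_symm.comp continuousOn_snd fun _ hq => hq.2))
    fun _ hq => ⟨hq.1, trivial⟩)

theorem contDiffAt_transport [T2Space M] (hf : ContMDiff (𝓡 n) 𝓘(ℝ, ℝ) ∞ f)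
    (hκ : κ ∈ IsManifold.maximalAtlas (𝓡 n) ∞ M)
    {t : ℝ} (ht : t ∈ Set.Ioo (0 : ℝ) 1) {y : Euc n} (hy : y ∈ κ.target) :
    ContDiffAt ℝ ∞ (p.transport f κ) (t, y) := by
  rw [← contMDiffAt_iff_contDiffAt]
  have h1 := (contMDiffOn_symm_of_mem_maximalAtlas hκ).contMDiffAt (κ.open_target.mem_nhds hy)
  have h2 : ContMDiffAt 𝓘(ℝ, ℝ × Euc n) (𝓘(ℝ, ℝ).prod (𝓡 n)) ∞
      (fun q : ℝ × Euc n => (q.1, κ.symm q.2)) (t, y) :=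
    contDiff_fst.contMDiff.contMDiffAt.prodMk
      (ContMDiffAt.comp (t, y) h1 contDiff_snd.contMDiff.contMDiffAt)
  have h3 : ContMDiffAt 𝓘(ℝ, ℝ × Euc n) (𝓡 n) ∞
      (fun q : ℝ × Euc n => p.inverse (q.1, κ.symm q.2)) (t, y) :=
    ContMDiffAt.comp (I' := 𝓘(ℝ, ℝ).prod (𝓡 n)) (g := p.inverse) (t, y)
      (p.contMDiffAt_inverse ht _) h2
  exact ContMDiffAt.comp (t, y) hf.contMDiffAt h3

/-- The transport equation `∂_t h + dh(u_t) = 0` for `h_t = f ∘ φ_t⁻¹`. -/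
theorem fderiv_transport [T2Space M] (hf : ContMDiff (𝓡 n) 𝓘(ℝ, ℝ) ∞ f)
    (hκ : κ ∈ IsManifold.maximalAtlas (𝓡 n) ∞ M)
    {t : ℝ} (ht : t ∈ Set.Ioo (0 : ℝ) 1) {y : Euc n} (hy : y ∈ κ.target) :
    fderiv ℝ (p.transport f κ) (t, y) (1, 0) =
      -fderiv ℝ (fun z => p.transport f κ (t, z)) y (chartField κ (p.velocity t) y) := by
  set x := p.inverse (t, κ.symm y) with hx
  have hφx : (p.toFun t).1 x = κ.symm y := p.apply_inverse t _
  have hxs : (p.toFun t).1 x ∈ κ.source := hφx ▸ κ.map_target hy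
  have hκx : κ ((p.toFun t).1 x) = y := by rw [hφx, κ.right_inv hy]
  have hd := ((p.contDiffAt_transport hf hκ ht hy).differentiableAt (by simp)).hasFDerivAt
  have h1 := p.hasDerivAt_chart_trajectory hκ ht hxs
  rw [hκx] at h1
  have h2 : HasDerivAt (fun τ => (τ, κ ((p.toFun τ).1 x)))
      ((1 : ℝ), chartField κ (p.velocity t) y) t := (hasDerivAt_id t).prodMk h1
  have h3 : HasDerivAt (fun τ => p.transport f κ (τ, κ ((p.toFun τ).1 x)))
      (fderiv ℝ (p.transport f κ) (t, y) (1, chartField κ (p.velocity t) y)) t :=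
    HasFDerivAt.comp_hasDerivAt (l := p.transport f κ) (f := fun τ => (τ, κ ((p.toFun τ).1 x))) t
      (by rwa [hκx]) h2
  have h4 : (fun τ => p.transport f κ (τ, κ ((p.toFun τ).1 x))) =ᶠ[𝓝 t] fun _ => f x := by
    filter_upwards [(p.contMDiffAt_trajectory ht x).continuousAt.eventually_mem
      (κ.open_source.mem_nhds hxs)] with τ hτ
    simp only [transport, κ.left_inv hτ, p.inverse_apply]
  have h5 := h3.unique ((hasDerivAt_const t (f x)).congr_of_eventuallyEq h4)
  have h6 : HasFDerivAt (fun z => p.transport f κ (t, z))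
      ((fderiv ℝ (p.transport f κ) (t, y)).comp (ContinuousLinearMap.inr ℝ ℝ (Euc n))) y :=
    HasFDerivAt.comp (g := p.transport f κ) (f := fun z : Euc n => (t, z)) y hd
      (hasFDerivAt_prodMk_right t y)
  rw [h6.fderiv, ContinuousLinearMap.comp_apply, ContinuousLinearMap.inr_apply,
    eq_neg_iff_add_eq_zero, ← map_add]
  simpa using h5

/-- Dominated convergence with bound `|η|`. Continuity up to the endpoints is needed because the
derivative is computed only at interior times. -/
theorem continuousOn_integral_transport [T2Space M] (hf : ContMDiff (𝓡 n) 𝓘(ℝ, ℝ) ∞ f)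
    {η : Euc n → ℝ} (hη : Continuous η) (hηc : HasCompactSupport η) (hηκ : tsupport η ⊆ κ.target) (hb : ∀ x, |f x| ≤ 1) :
    ContinuousOn (fun t => ∫ y, p.transport f κ (t, y) * η y) (Set.Icc 0 1) := by
  have hc := p.continuousOn_transport hf (κ := κ)
  refine continuousOn_of_dominated (bound := fun y => ‖η y‖) (fun t ht => ?_)
    (fun t ht => .of_forall fun y => ?_) (hη.norm.integrable_of_hasCompactSupport hηc.norm)
    (.of_forall fun y => ?_)
  · have h1 : ContinuousOn (fun y => p.transport f κ (t, y)) κ.target :=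
      hc.comp (f := fun y => (t, y)) (by fun_prop) fun y hy => ⟨ht, hy⟩
    exact (continuous_mul_of_tsupport_subset κ.open_target h1 hη hηκ).aestronglyMeasurable
  · rw [norm_mul]
    exact mul_le_of_le_one_left (norm_nonneg _) (hb _)
  · by_cases hy : y ∈ tsupport η
    · exact ContinuousOn.mul (hc.comp (f := fun t => (t, y)) (by fun_prop)
        fun t ht => ⟨ht, hηκ hy⟩) continuousOn_const
    · simp only [image_eq_zero_of_notMem_tsupport hy, mul_zero]
      exact continuousOn_const

theorem hasDerivAt_integral_transport [T2Space M] (hf : ContMDiff (𝓡 n) 𝓘(ℝ, ℝ) ∞ f)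
    (hκ : κ ∈ IsManifold.maximalAtlas (𝓡 n) ∞ M) {η : Euc n → ℝ} (hη : Continuous η)
    (hηc : HasCompactSupport η) (hηκ : tsupport η ⊆ κ.target)
    {t : ℝ} (ht : t ∈ Set.Ioo (0 : ℝ) 1) :
    HasDerivAt (fun t => ∫ y, p.transport f κ (t, y) * η y)
      (∫ y, fderiv ℝ (p.transport f κ) (t, y) (1, 0) * η y) t := by
  have hs : ContDiffOn ℝ ∞ (p.transport f κ) (Set.Ioo 0 1 ×ˢ κ.target) := fun q hq =>
    (p.contDiffAt_transport hf hκ hq.1 hq.2).contDiffWithinAt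
  have hfd : ContinuousOn (fun q => fderiv ℝ (p.transport f κ) q (1, 0))
      (Set.Ioo 0 1 ×ˢ κ.target) :=
    (hs.continuousOn_fderiv_of_isOpen (isOpen_Ioo.prod κ.open_target) (by simp)).clm_apply
      continuousOn_const
  obtain ⟨ε, hε, hεI⟩ := Metric.nhds_basis_closedBall.mem_iff.1 (isOpen_Ioo.mem_nhds ht)
  -- Compactness in time and space gives the dominating function for differentiation under the
  -- integral. This `C` may depend on the path.
  obtain ⟨C, hC⟩ := ((isCompact_closedBall t ε).prod hηc).exists_bound_of_continuousOn
    (hfd.mono (Set.prod_mono hεI hηκ))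
  have hslice : ∀ {k : ℝ × Euc n → ℝ}, ContinuousOn k (Set.Ioo 0 1 ×ˢ κ.target) →
      ∀ τ ∈ Set.Ioo (0 : ℝ) 1, Integrable fun y => k (τ, y) * η y := fun hk τ hτ =>
    integrable_mul_of_tsupport_subset κ.open_target
      (hk.comp (f := fun y => (τ, y)) (by fun_prop) fun y hy => ⟨hτ, hy⟩) hη hηc hηκ
  refine (hasDerivAt_integral_of_dominated_loc_of_deriv_le (bound := fun y => C * ‖η y‖)
    (F := fun t y => p.transport f κ (t, y) * η y)
    (F' := fun t y => fderiv ℝ (p.transport f κ) (t, y) (1, 0) * η y)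
    (Metric.closedBall_mem_nhds t hε) ?_ (hslice hs.continuousOn t ht)
    (hslice hfd t ht).aestronglyMeasurable (.of_forall fun y τ hτ => ?_)
    ((hη.norm.integrable_of_hasCompactSupport hηc.norm).const_mul C)
    (.of_forall fun y τ hτ => ?_)).2
  · filter_upwards [isOpen_Ioo.mem_nhds ht] with τ hτ
    exact (hslice hs.continuousOn τ hτ).aestronglyMeasurable
  · rw [norm_mul]
    by_cases hy : y ∈ tsupport η
    · exact mul_le_mul_of_nonneg_right (hC (τ, y) ⟨hτ, hy⟩) (norm_nonneg _)
    · simp [image_eq_zero_of_notMem_tsupport hy]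
  · by_cases hy : y ∈ tsupport η
    · have h1 := ((p.contDiffAt_transport hf hκ (hεI hτ) (hηκ hy)).differentiableAt
        (by simp)).hasFDerivAt
      have h2 : HasDerivAt (fun τ : ℝ => (τ, y)) ((1 : ℝ), (0 : Euc n)) τ :=
        (hasDerivAt_id τ).prodMk (hasDerivAt_const τ y)
      exact HasDerivAt.mul_const (HasFDerivAt.comp_hasDerivAt (f := fun τ : ℝ => (τ, y)) τ h1 h2)
        (η y)
    · simp only [image_eq_zero_of_notMem_tsupport hy, mul_zero]
      exact hasDerivAt_const _ _

end DiffPath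

/-! ### Positivity for order at least one -/

/-- The observed quantity is the average of `f ∘ φ_t⁻¹` against a bump `η` near a point where the
inverses of `φ₀` and `φ₁` differ. The constant must not depend on the path; it depends only on
`η/ρ_α`, since the transported functions share the bound one. -/
theorem geodesicDist_pos_of_one_le [T2Space M] [SigmaCompactSpace M]
    {g : RiemMetric n M} {ι : Type v} (A : NormalCover g ι) {s : ℝ} (hs : 1 ≤ s)
    {B : VectorFieldC n M → VectorFieldC n M → ℝ} (hB : IsEquivToSobolev A s B)
    {φ₀ φ₁ : DiffC n M} (hφ : φ₀ ≠ φ₁) : 0 < geodesicDist B φ₀ φ₁ := by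
  obtain ⟨y₀, hy₀⟩ : ∃ y, φ₀.1.symm y ≠ φ₁.1.symm y := by
    by_contra! h
    refine hφ (Subtype.ext (Diffeomorph.ext fun x => ?_))
    have := h (φ₀.1 x)
    rw [Diffeomorph.symm_apply_apply] at this
    conv_rhs => rw [this]
    rw [Diffeomorph.apply_symm_apply]
  obtain ⟨α, hys, V, hVt, hV, hyV, hpos⟩ := exists_chart_partition_pos A y₀
  set κ := A.chart α with hκdef
  have hκ : κ ∈ IsManifold.maximalAtlas (𝓡 n) ∞ M := (A.isNormal α).smooth
  obtain ⟨f, hf0, hf1, hf⟩ := exists_contMDiffMap_zero_one_of_isClosed (n := ⊤) (𝓡 n)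
    (isClosed_singleton (x := φ₁.1.symm y₀)) (isClosed_singleton (x := φ₀.1.symm y₀))
    (Set.disjoint_singleton.2 hy₀.symm)
  have hfs : ContMDiff (𝓡 n) 𝓘(ℝ, ℝ) ∞ f := f.contMDiff
  have hfb : ∀ x, |f x| ≤ 1 := fun x => abs_le.2 ⟨by linarith [(hf x).1], (hf x).2⟩
  -- the difference of the transported functions is at least `1/2` near `y₀`
  set d : Euc n → ℝ := fun y => f (φ₀.1.symm (κ.symm y)) - f (φ₁.1.symm (κ.symm y)) with hd
  have hdc : ContinuousOn d κ.target :=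
    (hfs.continuous.comp_continuousOn (φ₀.1.symm.continuous.comp_continuousOn
      κ.continuousOn_symm)).sub (hfs.continuous.comp_continuousOn
        (φ₁.1.symm.continuous.comp_continuousOn κ.continuousOn_symm))
  have hdy : d (κ y₀) = 1 := by
    simp only [hd, κ.left_inv hys]
    rw [hf0 rfl, hf1 rfl]
    simp
  have hnhds : V ∩ {y | 1 / 2 < d y} ∈ 𝓝 (κ y₀) :=
    Filter.inter_mem (hV.mem_nhds hyV) ((hdc.continuousAt (κ.open_target.mem_nhds
      (hVt hyV))).eventually_const_lt (by rw [hdy]; norm_num))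
  obtain ⟨r, hr, hrV⟩ := Metric.nhds_basis_closedBall.mem_iff.1 hnhds
  let b : ContDiffBump (κ y₀) := ⟨r / 2, r, by positivity, by linarith⟩
  -- Total mass one turns the pointwise gap `1/2` on the support into the change `c = 1/2` of the
  -- average.
  set η : Euc n → ℝ := b.normed volume with hη
  have hηs : ContDiff ℝ ∞ η := b.contDiff_normed
  have hηc : HasCompactSupport η := b.hasCompactSupport_normed
  have hηt : tsupport η = Metric.closedBall (κ y₀) r := b.tsupport_normed_eq
  have hηV : tsupport η ⊆ V := hηt ▸ hrV.trans Set.inter_subset_left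
  have hηκ : tsupport η ⊆ κ.target := hηV.trans hVt
  -- the test function divided by the partition of unity
  set ζ : Euc n → ℝ := fun y => (A.partition α (κ.symm y))⁻¹ * η y with hζ
  have hζt : tsupport ζ ⊆ tsupport η := tsupport_mul_subset_right
  have hζc : HasCompactSupport ζ := hηc.mul_left
  have hρs : ContDiffOn ℝ ∞ (fun y => A.partition α (κ.symm y)) κ.target := by
    rw [← contMDiffOn_iff_contDiffOn]
    exact (A.partition α).contMDiff.comp_contMDiffOn (contMDiffOn_symm_of_mem_maximalAtlas hκ)
  have hζs : ContDiff ℝ ∞ ζ := contMDiff_iff_contDiff.1 <| contMDiff_of_tsupport fun y hy => by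
    have hyV : y ∈ V := hηV (hζt hy)
    exact (((hρs.contDiffAt (κ.open_target.mem_nhds (hVt hyV))).inv (hpos y hyV).ne').mul
      hηs.contDiffAt).contMDiffAt
  obtain ⟨C, hC, hCb⟩ := exists_abs_integral_fderiv_le hs hζs hζc κ.open_target (hζt.trans hηκ)
  refine geodesicDist_pos (c := 1 / 2) (C := C) hB (by norm_num) fun p =>
    ⟨fun t => ∫ y, p.transport f κ (t, y) * η y,
      p.continuousOn_integral_transport hfs hηs.continuous hηc hηκ hfb, fun t ht => ?_, ?_⟩
  · have hderiv := p.hasDerivAt_integral_transport hfs hκ hηs.continuous hηc hηκ ht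
    refine ⟨hderiv.differentiableAt, ?_⟩
    rw [hderiv.deriv]
    -- On the support of `η` one has `ζ ρ_α = η`, so the transport equation can be written with the
    -- localised field that the norm controls.
    have hint : ∫ y, fderiv ℝ (p.transport f κ) (t, y) (1, 0) * η y =
        -∫ y, ζ y * fderiv ℝ (fun z => p.transport f κ (t, z)) y
          (localRep A α (p.velocity t) y) := by
      rw [← integral_neg]
      refine integral_congr_ae (.of_forall fun y => ?_)
      by_cases hy : y ∈ tsupport η
      · have hρ := (hpos y (hηV hy)).ne'
        simp only [hζ]
        rw [p.fderiv_transport hfs hκ ht (hηκ hy), localRep_apply_of_mem A α _ (hηκ hy),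
          map_smul, smul_eq_mul, ← hκdef]
        field_simp
      · simp [hζ, image_eq_zero_of_notMem_tsupport hy]
    rw [hint, abs_neg]
    refine hCb _ _ (localComponent A α (p.velocity t)) _ (fun y hy => ?_) (fun y => hfb _)
      (localComponent_apply A α _) fun k =>
        Real.sqrt_le_sqrt (sobolevNormSq_localComponent_le A s _ α k)
    have h1 := (p.contDiffAt_transport hfs hκ ht hy).comp (f := fun z : Euc n => (t, z)) y
      (by fun_prop)
    exact (h1.of_le (by simp)).contDiffWithinAt
  · have hi : ∀ φ : DiffC n M, Integrable fun y => f (φ.1.symm (κ.symm y)) * η y := fun φ =>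
      integrable_mul_of_tsupport_subset κ.open_target
        (hfs.continuous.comp_continuousOn (φ.1.symm.continuous.comp_continuousOn
          κ.continuousOn_symm)) hηs.continuous hηc hηκ
    simp only [DiffPath.transport, DiffPath.inverse, p.source, p.target]
    rw [abs_sub_comm, ← integral_sub (hi φ₀) (hi φ₁)]
    refine le_trans ?_ (le_abs_self _)
    calc (1 / 2 : ℝ) = ∫ y, 1 / 2 * η y := by
          rw [integral_const_mul, hη, b.integral_normed, mul_one]
      _ ≤ _ := by
          refine integral_mono ((hηs.continuous.integrable_of_hasCompactSupport hηc).const_mul _)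
            ((hi φ₀).sub (hi φ₁)) fun y => ?_
          simp only
          rw [← sub_mul]
          by_cases hy : y ∈ tsupport η
          · have h1 : 1 / 2 < d y := (hrV (hηt ▸ hy)).2
            exact mul_le_mul_of_nonneg_right h1.le (b.nonneg_normed y)
          · simp [image_eq_zero_of_notMem_tsupport hy]

end SobolevDiff

end

theorem mainTheorem2 {n : ℕ} {M : Type*} [TopologicalSpace M] [T2Space M] [SigmaCompactSpace M]
    [ChartedSpace (SobolevDiff.Euc n) M] [IsManifold (𝓡 n) ∞ M]
    (g : SobolevDiff.RiemMetric n M) {ι : Type*} (A : SobolevDiff.NormalCover g ι)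
    (s : ℝ) (hs : (n = 1 ∧ 1 / 2 < s) ∨ (2 ≤ n ∧ 1 ≤ s))
    (B : SobolevDiff.VectorFieldC n M → SobolevDiff.VectorFieldC n M → ℝ)
    (hB : SobolevDiff.IsEquivToSobolev A s B)
    (φ₀ φ₁ : SobolevDiff.DiffC n M) (hφ : φ₀ ≠ φ₁) :
    0 < SobolevDiff.geodesicDist B φ₀ φ₁ := by
  rcases hs with ⟨rfl, hs⟩ | ⟨-, hs⟩
  · exact SobolevDiff.geodesicDist_pos_of_lt A (by simpa using hs) hB hφ
  · exact SobolevDiff.geodesicDist_pos_of_one_le A hs hB hφ
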